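/- Let $\alpha,\beta,\gamma>-1$ with $\alpha\neq\beta$ and $|\alpha-\beta|<1$. On $[0,1]$ consider the Jacobi–Piñeiro system with weights $w_1(x)=x^{\alpha}$, $w_2(x)=x^{\beta}$ and measure $d\mu(x)=(1-x)^{\gamma}dx$. For $l\in\mathbb{N}_0$ put $\vec\nu(l)=(\lfloor (l+1)/2\rfloor,\lfloor l/2\rfloor)$, that is, $\vec\nu(2n)=(n,n)$ and $\vec\nu(2n+1)=(n+1,n)$. (i) For every $l\in\mathbb{N}_0$ there is a unique monic polynomial $B^{(l)}$ of degree $l$ (type II) with $$\int_0^1 B^{(l)}(x)\,w_a(x)\,x^{j}\,d\mu(x)=0,\qquad 0\le j<\nu_a(l),\quad a=1,2,$$ and there is a unique pair of polynomials $A^{(l)}_1,A^{(l)}_2$ (type I) with $\deg A^{(l)}_a<\nu_a(l+1)$ (the zero polynomial being allowed, and forced if $\nu_a(l+1)=0$) such that the linear form $Q^{(l)}(x):=A^{(l)}_1(x)x^{\alpha}+A^{(l)}_2(x)x^{\beta}$ satisfies $$\int_0^1 x^{j}Q^{(l)}(x)\,d\mu(x)=0\quad(0\le j<l),\qquad \int_0^1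 x^{l}Q^{(l)}(x)\,d\mu(x)=1.$$ (ii) Let $J=(J_{n,m})_{n,m\ge0}$ be the Jacobi matrix, i.e. the matrix of multiplication by $x$ in the basis $(B^{(n)})_{n\ge 0}$: $xB^{(n)}(x)=\sum_m J_{n,m}B^{(m)}(x)$. Then $J_{n,n+1}=1$ for all $n$, and $J_{n,m}=0$ if $m>n+1$ or $m<n-2$. (iii) $Q^{(n)}(x)>0$ for all $n\in\mathbb{N}_0$ and all real $x\ge1$. (iv) The semi-infinite matrix $P_I=(P_{I,n,m})_{n,m\ge0}$, $$P_{I,n,m}=\frac{Q^{(m)}(1)}{Q^{(n)}(1)}\,J_{m,n},$$ is a multiple stochastic matrix of type I: $0\le P_{I,n,m}\le 1$ for all $n,m$, $\sum_{m\ge0}P_{I,n,m}=1$ for every $n$, and $P_{I,n,m}=0$ if $m<n-1$ or $m>n+2$. In particular $P_{I,n+1,n}=Q^{(n)}(1)/Q^{(n+1)}(1)$. (In the associated Markov chain each transition goes to one of the two next states, stays, or goes one state back.) -/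

import Mathlib

open Polynomial

noncomputable section

namespace JacobiPineiro

/-- The linear functional `f ↦ ∫₀¹ f(x) (1 - x)^γ dx`, i.e. integration against the measure `μ`. -/
def integralMu (γ : ℝ) (f : ℝ → ℝ) : ℝ :=
  ∫ x in (0 : ℝ)..1, f x * (1 - x) ^ γ

/-- The step-line multi-index of length `l`: `ν(2n) = (n, n)`, `ν(2n+1) = (n+1, n)`. -/
def stepLine (l : ℕ) : ℕ × ℕ := ((l + 1) / 2, l / 2)

/-- The `j`-th entry of the sequence of weighted monomials `x^α, x^β, x·x^α, x·x^β, x²·x^α, …`. -/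
def weightedMonomial (α β : ℝ) (j : ℕ) (x : ℝ) : ℝ :=
  x ^ (j / 2) * x ^ (if Even j then α else β)

/-- The moment matrix `g`. -/
def moment (α β γ : ℝ) (i j : ℕ) : ℝ :=
  integralMu γ (fun x => x ^ i * weightedMonomial α β j x)

/-- The leading `l × l` truncation of the moment matrix. -/
def momentTrunc (α β γ : ℝ) (l : ℕ) : Matrix (Fin l) (Fin l) ℝ :=
  Matrix.of fun i j => moment α β γ i j

/-- `p` is the monic type II multiple orthogonal polynomial of multi-index `(ν₁, ν₂)`, for the
weights `x^α, x^β` and the measure `(1 - x)^γ dx` on `[0, 1]`. -/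
def IsMonicTypeII (α β γ : ℝ) (ν : ℕ × ℕ) (p : ℝ[X]) : Prop :=
  p.Monic ∧ p.natDegree = ν.1 + ν.2 ∧
  (∀ j < ν.1, integralMu γ (fun x => p.eval x * x ^ α * x ^ j) = 0) ∧
  (∀ j < ν.2, integralMu γ (fun x => p.eval x * x ^ β * x ^ j) = 0)

/-- `(a₁, a₂)` are the normalized type I multiple orthogonal polynomials of multi-index
`(ν₁, ν₂)`. -/
def IsTypeI (α β γ : ℝ) (ν : ℕ × ℕ) (a₁ a₂ : ℝ[X]) : Prop :=
  a₁.degree < (ν.1 : WithBot ℕ) ∧ a₂.degree < (ν.2 : WithBot ℕ) ∧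
  (∀ j, j + 1 < ν.1 + ν.2 →
    integralMu γ (fun x => x ^ j * (a₁.eval x * x ^ α + a₂.eval x * x ^ β)) = 0) ∧
  integralMu γ (fun x =>
    x ^ (ν.1 + ν.2 - 1) * (a₁.eval x * x ^ α + a₂.eval x * x ^ β)) = 1

/-- The part of degree `< l` of `B^{(l)}`, with the sign changed: the coefficients solve the
orthogonality relations against the first `l` weighted monomials. -/
def lowerPartB (α β γ : ℝ) (l : ℕ) : ℝ[X] :=
  ∑ i : Fin l, C (∑ j : Fin l, moment α β γ l j * (momentTrunc α β γ l)⁻¹ j i) * X ^ (i : ℕ)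

/-- The type II polynomial `B^{(l)}` on the step-line. -/
def polyB (α β γ : ℝ) (l : ℕ) : ℝ[X] := X ^ l - lowerPartB α β γ l

/-- The coefficient of the `j`-th weighted monomial in `Q^{(l)}`, `j ≤ l`. -/
def coeffQ (α β γ : ℝ) (l : ℕ) (j : Fin (l + 1)) : ℝ :=
  (momentTrunc α β γ (l + 1))⁻¹ j (Fin.last l)

/-- The type I polynomial `A₁^{(l)}` on the step-line. -/
def polyA₁ (α β γ : ℝ) (l : ℕ) : ℝ[X] :=
  ∑ j : Fin (l + 1), if Even (j : ℕ) then C (coeffQ α β γ l j) * X ^ ((j : ℕ) / 2) else 0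

/-- The type I polynomial `A₂^{(l)}` on the step-line. -/
def polyA₂ (α β γ : ℝ) (l : ℕ) : ℝ[X] :=
  ∑ j : Fin (l + 1), if Even (j : ℕ) then 0 else C (coeffQ α β γ l j) * X ^ ((j : ℕ) / 2)

/-- The type I linear form `Q^{(l)}(x) = A₁^{(l)}(x) x^α + A₂^{(l)}(x) x^β`. In terms of
multi-indices, `Q^{(2n)} = Q_{(n+1,n)}` and `Q^{(2n+1)} = Q_{(n+1,n+1)}`. -/
def formQ (α β γ : ℝ) (l : ℕ) (x : ℝ) : ℝ :=
  (polyA₁ α β γ l).eval x * x ^ α + (polyA₂ α β γ l).eval x * x ^ β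

theorem degree_lowerPartB_lt (α β γ : ℝ) (l : ℕ) :
    (lowerPartB α β γ l).degree < (l : WithBot ℕ) := by
  unfold lowerPartB
  refine lt_of_le_of_lt (degree_sum_le _ _) ?_
  refine (Finset.sup_lt_iff (WithBot.bot_lt_coe l)).2 fun i _ => ?_
  exact lt_of_le_of_lt (degree_C_mul_X_pow_le _ _) (WithBot.coe_lt_coe.2 i.2)

theorem monic_polyB (α β γ : ℝ) (l : ℕ) : (polyB α β γ l).Monic :=
  monic_X_pow_sub (degree_lowerPartB_lt α β γ l)

theorem degree_polyB (α β γ : ℝ) (l : ℕ) : (polyB α β γ l).degree = l := by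
  unfold polyB
  rw [degree_sub_eq_left_of_degree_lt] <;> rw [degree_X_pow]
  exact degree_lowerPartB_lt α β γ l

/-- The type II polynomials as a degree-graded sequence, hence a basis of `ℝ[X]`. -/
def seqB (α β γ : ℝ) : Polynomial.Sequence ℝ := ⟨polyB α β γ, degree_polyB α β γ⟩

theorem isUnit_leadingCoeff_seqB (α β γ : ℝ) (i : ℕ) :
    IsUnit (seqB α β γ i).leadingCoeff := by
  have h : (seqB α β γ i).leadingCoeff = 1 := monic_polyB α β γ i
  rw [h]
  exact isUnit_one

/-- The Jacobi matrix: the matrix of multiplication by `x` in the basis `B^{(0)}, B^{(1)}, …`,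
i.e. `x B^{(n)}(x) = ∑ₘ J n m * B^{(m)}(x)`, a finite sum. -/
def jacobiMatrix (α β γ : ℝ) : Matrix ℕ ℕ ℝ := Matrix.of fun n m =>
  ((seqB α β γ).basis (isUnit_leadingCoeff_seqB α β γ)).repr (X * polyB α β γ n) m

/-- The matrix `σ Jᵀ σ⁻¹` with `σ = diag (1 / Q^{(n)}(1))`. -/
def matrixPI (α β γ : ℝ) : Matrix ℕ ℕ ℝ := Matrix.of fun n m =>
  formQ α β γ m 1 / formQ α β γ n 1 * jacobiMatrix α β γ m n

/-- A semi-infinite stochastic matrix. -/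
def IsStochastic (P : Matrix ℕ ℕ ℝ) : Prop :=
  (∀ i j, 0 ≤ P i j ∧ P i j ≤ 1) ∧ ∀ i, HasSum (fun j => P i j) 1

/-- A multiple stochastic matrix of type I: one subdiagonal and `N` superdiagonals. -/
def IsMultipleStochasticTypeI (N : ℕ) (P : Matrix ℕ ℕ ℝ) : Prop :=
  IsStochastic P ∧ (∀ i j, j + 1 < i → P i j = 0) ∧ (∀ i j, i + N < j → P i j = 0)

end JacobiPineiro

end

/-! The weighted monomials are pure powers `x ^ e j` with `e = exponent α β`, where `e (j + 2) = e j
+ 1` and, by the conditions on `α - β`, the `e j` are distinct. Everything is expressed through the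
bilinear form `pairing`, in which a linear form `∑ v_j x ^ e j` is encoded by the polynomial `∑ v_j
X ^ j`. Multiplying a form by `x` multiplies its encoding by `X ^ 2`.

Mellin transform: for `p` of degree at most `n`, the integral of `p x^s dμ` is a Beta value times a
polynomial in `s` of degree at most `n`, divided by the Pochhammer symbol `(s + γ + 2)_n`.
Orthogonality prescribes the zeros `e 0, …, e (n - 1)` of that polynomial. Hence the moment matrices
are nonsingular, the sign of `∫ B^{(n)} x ^ e n dμ` is that of `∏ (e n - e j)`
(`pairing_mul_prod_pos`), and the subleading coefficient of `B^{(n)}` is explicit (`coeff_eq`).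

Nonnegativity of `J`: let `B'` be the type II polynomials for `(α + 1, β + 1)`. Then `x B'_n =
B_{n+1} + d B_n` and `B_n = B'_n + l₁ B'_{n-1} + l₂ B'_{n-2}`. The numbers `d` and `l₂` are
quotients of normalization constants, whose signs are known, and `l₁` is a difference of subleading
coefficients. All are nonnegative, and substituting one relation into the other gives the recurrence
with nonnegative coefficients.

Positivity of `Q^{(l)}`: a combination of `l + 1` real powers has at most `l` positive zeros, while
the orthogonality relations force `l` sign changes in `(0, 1)`. No zero is left for `[1, ∞)`, and
the normalization fixes the sign (`evalForm_polyQ_pos`).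

Stochasticity: by biorthogonality the forms satisfy the transposed recurrence `x Q^{(n)} = ∑ J_{m,n}
Q^{(m)}`. At `x = 1` it says that the rows of `P_I` sum to 1. -/

noncomputable section

namespace JacobiPineiro

/-! ### Moments of real order as Beta values -/

/-- The moment `∫₀¹ x^s (1 - x)^γ dx` of real order `s`. -/
def realMoment (γ s : ℝ) : ℝ := integralMu γ (fun x => x ^ s)

/-- The exponent of the `j`-th weighted monomial. -/
def exponent (α β : ℝ) (j : ℕ) : ℝ := ((j / 2 : ℕ) : ℝ) + if Even j then α else β

theorem rpow_mul_one_sub_rpow_eq_re {γ s x : ℝ} (hx : x ∈ Set.Ioc (0 : ℝ) 1) :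
    x ^ s * (1 - x) ^ γ = ((x : ℂ) ^ (((s + 1 : ℝ) : ℂ) - 1) *
      (1 - (x : ℂ)) ^ (((γ + 1 : ℝ) : ℂ) - 1)).re := by
  have h1 : (((s + 1 : ℝ) : ℂ) - 1) = ((s : ℝ) : ℂ) := by push_cast; ring
  have h2 : (((γ + 1 : ℝ) : ℂ) - 1) = ((γ : ℝ) : ℂ) := by push_cast; ring
  have h3 : (1 - (x : ℂ)) = ((1 - x : ℝ) : ℂ) := by push_cast; ring
  rw [h1, h2, h3, ← Complex.ofReal_cpow hx.1.le, ← Complex.ofReal_cpow (sub_nonneg.2 hx.2),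
    ← Complex.ofReal_mul, Complex.ofReal_re]

theorem intervalIntegrable_betaKernel {γ s : ℝ} (hγ : -1 < γ) (hs : -1 < s) :
    IntervalIntegrable (fun x : ℝ => (x : ℂ) ^ (((s + 1 : ℝ) : ℂ) - 1) *
      (1 - (x : ℂ)) ^ (((γ + 1 : ℝ) : ℂ) - 1)) MeasureTheory.volume 0 1 :=
  Complex.betaIntegral_convergent (by simp; linarith) (by simp; linarith)

theorem intervalIntegrable_rpow_mul {γ s : ℝ} (hγ : -1 < γ) (hs : -1 < s) :
    IntervalIntegrable (fun x : ℝ => x ^ s * (1 - x) ^ γ) MeasureTheory.volume 0 1 := by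
  have h := intervalIntegrable_betaKernel hγ hs
  rw [intervalIntegrable_iff_integrableOn_Ioc_of_le zero_le_one] at h ⊢
  exact (MeasureTheory.Integrable.re h).congr
    ((MeasureTheory.ae_restrict_iff' measurableSet_Ioc).2
      (Filter.Eventually.of_forall fun x hx => (rpow_mul_one_sub_rpow_eq_re hx).symm))

theorem realMoment_eq_beta {γ s : ℝ} (hγ : -1 < γ) (hs : -1 < s) :
    realMoment γ s = ProbabilityTheory.beta (s + 1) (γ + 1) := by
  have h := intervalIntegrable_betaKernel hγ hs
  rw [intervalIntegrable_iff_integrableOn_Ioc_of_le zero_le_one] at h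
  rw [ProbabilityTheory.beta_eq_betaIntegralReal _ _ (by linarith) (by linarith),
    Complex.betaIntegral, realMoment, integralMu, intervalIntegral.integral_of_le zero_le_one,
    intervalIntegral.integral_of_le zero_le_one, ← RCLike.re_to_complex, ← integral_re h]
  exact MeasureTheory.setIntegral_congr_fun measurableSet_Ioc
    fun x hx => rpow_mul_one_sub_rpow_eq_re hx

theorem realMoment_pos {γ s : ℝ} (hγ : -1 < γ) (hs : -1 < s) : 0 < realMoment γ s := by
  rw [realMoment_eq_beta hγ hs]
  exact ProbabilityTheory.beta_pos (by linarith) (by linarith)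

theorem realMoment_add_one {γ s : ℝ} (hγ : -1 < γ) (hs : -1 < s) :
    realMoment γ (s + 1) * (s + γ + 2) = realMoment γ s * (s + 1) := by
  rw [realMoment_eq_beta hγ hs, realMoment_eq_beta hγ (by linarith), ProbabilityTheory.beta,
    ProbabilityTheory.beta, Real.Gamma_add_one (by linarith : s + 1 ≠ 0),
    show s + 1 + 1 + (γ + 1) = (s + 1 + (γ + 1)) + 1 by ring,
    Real.Gamma_add_one (by linarith : s + 1 + (γ + 1) ≠ 0)]
  have h1 : s + 1 + (γ + 1) ≠ 0 := by linarith
  have h2 := (Real.Gamma_pos_of_pos (by linarith : 0 < s + 1 + (γ + 1))).ne'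
  field_simp
  ring

/-! ### Exponents of the weighted monomials -/

theorem neg_one_lt_exponent {α β : ℝ} (hα : -1 < α) (hβ : -1 < β) (j : ℕ) :
    -1 < exponent α β j := by
  have : (0 : ℝ) ≤ ((j / 2 : ℕ) : ℝ) := Nat.cast_nonneg _
  unfold exponent; split_ifs <;> linarith

theorem exponent_add_two (α β : ℝ) (j : ℕ) : exponent α β (j + 2) = exponent α β j + 1 := by
  have : (j + 2) / 2 = j / 2 + 1 := by omega
  simp only [exponent, this, Nat.even_add, even_two, iff_true]
  push_cast; ring

theorem exponent_shift (α β : ℝ) (j : ℕ) :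
    exponent (α + 1) (β + 1) j = exponent α β j + 1 := by
  unfold exponent; split_ifs <;> ring

theorem exponent_two_mul (α β : ℝ) (k : ℕ) : exponent α β (2 * k) = k + α := by
  simp [exponent]

theorem exponent_two_mul_add_one (α β : ℝ) (k : ℕ) : exponent α β (2 * k + 1) = k + β := by
  have : (2 * k + 1) / 2 = k := by omega
  simp [exponent, this]

/-- A coincidence between the families `k + α` and `m + β` would make `α - β` an integer of absolute
value less than 1, hence zero. -/
theorem exponent_injective {α β : ℝ} (hne : α ≠ β) (hlt : |α - β| < 1) :
    Function.Injective (exponent α β) := by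
  have key : ∀ k m : ℕ, (k : ℝ) + α ≠ m + β := by
    intro k m h
    have h1 : α - β = ((m - k : ℤ) : ℝ) := by push_cast; linarith
    rw [h1] at hlt
    have h2 : |(m - k : ℤ)| < 1 := by exact_mod_cast hlt
    rw [Int.abs_lt_one_iff] at h2
    rw [h2] at h1
    exact hne (by simpa [sub_eq_zero] using h1)
  intro i j h
  obtain ⟨k, rfl | rfl⟩ := i.even_or_odd' <;> obtain ⟨m, rfl | rfl⟩ := j.even_or_odd' <;>
    simp only [exponent_two_mul, exponent_two_mul_add_one] at h
  · have : k = m := by exact_mod_cast add_right_cancel h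
    omega
  · exact absurd h (key _ _)
  · exact absurd h.symm (key _ _)
  · have : k = m := by exact_mod_cast add_right_cancel h
    omega

theorem weightedMonomial_eq_rpow (α β : ℝ) (j : ℕ) {x : ℝ} (hx : 0 < x) :
    weightedMonomial α β j x = x ^ exponent α β j := by
  rw [weightedMonomial, exponent, Real.rpow_add hx, Real.rpow_natCast]

theorem pow_mul_weightedMonomial (α β : ℝ) (i j : ℕ) {x : ℝ} (hx : 0 < x) :
    x ^ i * weightedMonomial α β j x = x ^ (i + exponent α β j) := by
  rw [weightedMonomial_eq_rpow _ _ _ hx, Real.rpow_add hx, Real.rpow_natCast]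

theorem moment_eq_realMoment (α β γ : ℝ) (i j : ℕ) :
    moment α β γ i j = realMoment γ (i + exponent α β j) := by
  unfold moment realMoment integralMu
  rw [intervalIntegral.integral_of_le zero_le_one, intervalIntegral.integral_of_le zero_le_one]
  exact MeasureTheory.setIntegral_congr_fun measurableSet_Ioc
    fun x hx => by simp only [pow_mul_weightedMonomial _ _ _ _ hx.1]

theorem intervalIntegrable_moment {α β γ : ℝ} (hα : -1 < α) (hβ : -1 < β) (hγ : -1 < γ)
    (i j : ℕ) : IntervalIntegrable
      (fun x => (x ^ i * weightedMonomial α β j x) * (1 - x) ^ γ) MeasureTheory.volume 0 1 := by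
  have h1 := neg_one_lt_exponent hα hβ j
  have h2 : (0 : ℝ) ≤ i := Nat.cast_nonneg _
  refine (intervalIntegrable_rpow_mul hγ (by linarith : -1 < i + exponent α β j)).congr ?_
  intro x hx
  rw [Set.uIoc_of_le zero_le_one] at hx
  simp only [pow_mul_weightedMonomial _ _ _ _ hx.1]

theorem moment_shift (α β γ : ℝ) (i j : ℕ) :
    moment (α + 1) (β + 1) γ i j = moment α β γ (i + 1) j := by
  rw [moment_eq_realMoment, moment_eq_realMoment, exponent_shift]
  push_cast; congr 1; ring

theorem moment_add_two (α β γ : ℝ) (i j : ℕ) :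
    moment α β γ i (j + 2) = moment α β γ (i + 1) j := by
  rw [moment_eq_realMoment, moment_eq_realMoment, exponent_add_two]
  push_cast; congr 1; ring

/-! ### The bilinear pairing and its two shift rules -/

/-- The bilinear pairing `(p, v) ↦ ∫ p(x) ∑ⱼ vⱼ ωⱼ(x) dμ(x)`, where `ωⱼ` is the `j`-th weighted
monomial. A linear form is encoded by the polynomial with the same coefficients. -/
def pairing (α β γ : ℝ) : ℝ[X] →ₗ[ℝ] ℝ[X] →ₗ[ℝ] ℝ :=
  Polynomial.lsum fun i => LinearMap.toSpanSingleton ℝ _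
    (Polynomial.lsum fun j => moment α β γ i j • LinearMap.id)

theorem pairing_apply (α β γ : ℝ) (p v : ℝ[X]) :
    pairing α β γ p v = p.sum fun i a => v.sum fun j b => a * (moment α β γ i j * b) := by
  simp [pairing, Polynomial.lsum_apply, Polynomial.sum, LinearMap.sum_apply, Finset.mul_sum]

theorem pairing_X_pow (α β γ : ℝ) (i j : ℕ) :
    pairing α β γ (X ^ i) (X ^ j) = moment α β γ i j := by
  rw [pairing_apply, ← monomial_one_right_eq_X_pow, ← monomial_one_right_eq_X_pow,
    sum_monomial_index _ _ (by simp), sum_monomial_index _ _ (by simp)]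
  ring

/-- The linear form encoded by a polynomial. -/
def evalForm (α β : ℝ) (v : ℝ[X]) (x : ℝ) : ℝ := v.sum fun j b => b * weightedMonomial α β j x

theorem eval_mul_evalForm_mul (α β γ : ℝ) (p v : ℝ[X]) (x : ℝ) :
    (p.eval x * evalForm α β v x) * (1 - x) ^ γ =
      ∑ i ∈ p.support, ∑ j ∈ v.support, p.coeff i * v.coeff j *
        ((x ^ i * weightedMonomial α β j x) * (1 - x) ^ γ) := by
  rw [eval_eq_sum, Polynomial.sum, evalForm, Polynomial.sum, Finset.sum_mul_sum, Finset.sum_mul]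
  refine Finset.sum_congr rfl fun i _ => ?_
  rw [Finset.sum_mul]
  exact Finset.sum_congr rfl fun j _ => by ring

theorem intervalIntegrable_sum_moment {α β γ : ℝ} (hα : -1 < α) (hβ : -1 < β) (hγ : -1 < γ)
    (i : ℕ) (c : ℕ → ℝ) (s : Finset ℕ) : IntervalIntegrable
      (fun x => ∑ j ∈ s, c j * ((x ^ i * weightedMonomial α β j x) * (1 - x) ^ γ))
      MeasureTheory.volume 0 1 := by
  simpa only [Finset.sum_fn] using IntervalIntegrable.sum s fun j _ =>
    (intervalIntegrable_moment hα hβ hγ i j).const_mul (c j)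

theorem intervalIntegrable_eval_mul_evalForm {α β γ : ℝ} (hα : -1 < α) (hβ : -1 < β)
    (hγ : -1 < γ) (p v : ℝ[X]) :
    IntervalIntegrable (fun x => (p.eval x * evalForm α β v x) * (1 - x) ^ γ)
      MeasureTheory.volume 0 1 := by
  simp only [eval_mul_evalForm_mul]
  simpa only [Finset.sum_fn] using IntervalIntegrable.sum p.support fun i _ =>
    intervalIntegrable_sum_moment hα hβ hγ i (fun j => p.coeff i * v.coeff j) v.support

theorem pairing_eq_integral {α β γ : ℝ} (hα : -1 < α) (hβ : -1 < β) (hγ : -1 < γ) (p v : ℝ[X]) :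
    pairing α β γ p v = integralMu γ fun x => p.eval x * evalForm α β v x := by
  simp only [integralMu, eval_mul_evalForm_mul]
  rw [pairing_apply, intervalIntegral.integral_finsetSum fun i _ =>
    intervalIntegrable_sum_moment hα hβ hγ i (fun j => p.coeff i * v.coeff j) v.support]
  refine Finset.sum_congr rfl fun i _ => ?_
  rw [intervalIntegral.integral_finsetSum fun j _ =>
    (intervalIntegrable_moment hα hβ hγ i j).const_mul _]
  refine Finset.sum_congr rfl fun j _ => ?_
  rw [intervalIntegral.integral_const_mul]
  simp only [moment, integralMu]
  ring

/-- Raising both exponents by one multiplies both weights by `x` (a Christoffel transformation). -/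
theorem pairing_shift (α β γ : ℝ) (p v : ℝ[X]) :
    pairing (α + 1) (β + 1) γ p v = pairing α β γ (X * p) v := by
  have : pairing (α + 1) (β + 1) γ = pairing α β γ ∘ₗ LinearMap.mulLeft ℝ X := by
    ext i j
    simp [monomial_one_right_eq_X_pow, ← pow_succ', pairing_X_pow, moment_shift]
  simp [this]

theorem pairing_X_mul (α β γ : ℝ) (p v : ℝ[X]) :
    pairing α β γ (X * p) v = pairing α β γ p (X ^ 2 * v) := by
  have : pairing α β γ ∘ₗ LinearMap.mulLeft ℝ X =
      (pairing α β γ).compl₂ (LinearMap.mulLeft ℝ (X ^ 2)) := by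
    ext i j
    simp [monomial_one_right_eq_X_pow, ← pow_succ', ← pow_add, add_comm 2, pairing_X_pow,
      moment_add_two]
  simpa using LinearMap.congr_fun (LinearMap.congr_fun this p) v

/-! ### The Mellin transform of a polynomial -/

theorem ascPochhammer_eval_neg_natCast {r k : ℕ} (h : r < k) :
    (ascPochhammer ℝ k).eval (-(r : ℝ)) = 0 := by
  rw [ascPochhammer_eval_neg_eq_descPochhammer, descPochhammer_eval_eq_descFactorial,
    Nat.descFactorial_eq_zero_iff_lt.2 h]
  simp

theorem ascPochhammer_eval_one_sub_sub (k : ℕ) (c : ℝ) :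
    (ascPochhammer ℝ k).eval (1 - c - k) = (-1) ^ k * (ascPochhammer ℝ k).eval c := by
  rw [show (1 - c - k : ℝ) = -(c + k - 1) by ring, ascPochhammer_eval_neg_eq_descPochhammer,
    descPochhammer_eval_eq_ascPochhammer]
  ring_nf

theorem realMoment_add_natCast {γ s : ℝ} (hγ : -1 < γ) (hs : -1 < s) (i : ℕ) :
    realMoment γ (i + s) * (ascPochhammer ℝ i).eval (s + γ + 2) =
      realMoment γ s * (ascPochhammer ℝ i).eval (s + 1) := by
  induction i with
  | zero => simp
  | succ i ih =>
    have h0 : (0 : ℝ) ≤ i := Nat.cast_nonneg _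
    have h := realMoment_add_one hγ (by linarith : -1 < i + s)
    rw [ascPochhammer_succ_eval, ascPochhammer_succ_eval, Nat.cast_succ,
      show (i : ℝ) + 1 + s = i + s + 1 by ring]
    linear_combination (ascPochhammer ℝ i).eval (s + γ + 2) * h + (s + 1 + i) * ih

/-- The polynomial factor of the Mellin transform of `p dμ`, for `p` of degree at most `n`. -/
def mellinPoly (γ : ℝ) (n : ℕ) (p : ℝ[X]) : ℝ[X] :=
  ∑ i ∈ Finset.range (n + 1), C (p.coeff i) * ((ascPochhammer ℝ i).comp (X + C 1) *
    (ascPochhammer ℝ (n - i)).comp (X + C (γ + 2 + i)))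

theorem eval_mellinPoly (γ : ℝ) (n : ℕ) (p : ℝ[X]) (s : ℝ) :
    (mellinPoly γ n p).eval s = ∑ i ∈ Finset.range (n + 1), p.coeff i *
      ((ascPochhammer ℝ i).eval (s + 1) * (ascPochhammer ℝ (n - i)).eval (s + (γ + 2 + i))) := by
  simp [mellinPoly, eval_finsetSum, eval_comp]

theorem natDegree_mellinPoly_le (γ : ℝ) (n : ℕ) (p : ℝ[X]) :
    (mellinPoly γ n p).natDegree ≤ n := by
  refine natDegree_sum_le_of_forall_le _ _ fun i hi => ?_
  have hi' : i ≤ n := Nat.lt_succ_iff.1 (Finset.mem_range.1 hi)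
  refine (natDegree_C_mul_le _ _).trans (natDegree_mul_le.trans ?_)
  rw [natDegree_comp, natDegree_comp, natDegree_X_add_C, natDegree_X_add_C,
    ascPochhammer_natDegree, ascPochhammer_natDegree]
  omega

theorem pairing_right_X_pow {α β γ : ℝ} {n : ℕ} {p : ℝ[X]} (hp : p.natDegree ≤ n) (j : ℕ) :
    pairing α β γ p (X ^ j) =
      ∑ i ∈ Finset.range (n + 1), p.coeff i * moment α β γ i j := by
  conv_lhs => rw [p.as_sum_range' (n + 1) (Nat.lt_succ_of_le hp)]
  rw [map_sum, LinearMap.sum_apply]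
  refine Finset.sum_congr rfl fun i _ => ?_
  rw [← C_mul_X_pow_eq_monomial, ← smul_eq_C_mul, map_smul, LinearMap.smul_apply, pairing_X_pow,
    smul_eq_mul]

/-- The moment of order `i + s` is the one of order `s` times `(s + 1)_i / (s + γ + 2)_i`; the
factor `(s + γ + 2)_n` is a common denominator for all `i ≤ n`. -/
theorem pairing_mul_ascPochhammer {α β γ : ℝ} (hα : -1 < α) (hβ : -1 < β) (hγ : -1 < γ)
    {n : ℕ} {p : ℝ[X]} (hp : p.natDegree ≤ n) (j : ℕ) :
    pairing α β γ p (X ^ j) * (ascPochhammer ℝ n).eval (exponent α β j + γ + 2) =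
      realMoment γ (exponent α β j) * (mellinPoly γ n p).eval (exponent α β j) := by
  have hs := neg_one_lt_exponent hα hβ j
  rw [pairing_right_X_pow hp, eval_mellinPoly, Finset.sum_mul, Finset.mul_sum]
  refine Finset.sum_congr rfl fun i hi => ?_
  have hi' : i ≤ n := Nat.lt_succ_iff.1 (Finset.mem_range.1 hi)
  have h1 := realMoment_add_natCast hγ hs i
  have h2 := congrArg (eval (exponent α β j + γ + 2)) (ascPochhammer_mul ℝ i (n - i))
  rw [Nat.add_sub_cancel' hi', eval_mul, eval_comp, eval_add, eval_X, eval_natCast] at h2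
  rw [moment_eq_realMoment, ← h2,
    show exponent α β j + (γ + 2 + i) = exponent α β j + γ + 2 + i by ring]
  linear_combination p.coeff i *
    (ascPochhammer ℝ (n - i)).eval (exponent α β j + γ + 2 + i) * h1

theorem ascPochhammer_exponent_pos {α β γ : ℝ} (hα : -1 < α) (hβ : -1 < β) (hγ : -1 < γ)
    (n j : ℕ) : 0 < (ascPochhammer ℝ n).eval (exponent α β j + γ + 2) :=
  ascPochhammer_pos _ _ (by linarith [neg_one_lt_exponent hα hβ j])

theorem eval_mellinPoly_eq_zero_iff {α β γ : ℝ} (hα : -1 < α) (hβ : -1 < β) (hγ : -1 < γ)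
    {n : ℕ} {p : ℝ[X]} (hp : p.natDegree ≤ n) (j : ℕ) :
    (mellinPoly γ n p).eval (exponent α β j) = 0 ↔ pairing α β γ p (X ^ j) = 0 := by
  have h := pairing_mul_ascPochhammer hα hβ hγ hp j
  have h1 := (ascPochhammer_exponent_pos hα hβ hγ n j).ne'
  have h2 := (realMoment_pos hγ (neg_one_lt_exponent hα hβ j)).ne'
  constructor <;> intro h0 <;> rw [h0] at h <;> simpa [h1, h2] using h

/-- At `s = -γ - n - 1` the second Pochhammer factor vanishes for every `i < n`, so only the leading
coefficient survives. -/
theorem eval_mellinPoly_top (γ : ℝ) (n : ℕ) (p : ℝ[X]) :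
    (mellinPoly γ n p).eval (-γ - n - 1) =
      (-1) ^ n * (ascPochhammer ℝ n).eval (γ + 1) * p.coeff n := by
  rw [eval_mellinPoly, Finset.sum_range_succ, Finset.sum_eq_zero, zero_add, Nat.sub_self,
    ascPochhammer_zero, eval_one, mul_one, ← ascPochhammer_eval_one_sub_sub, mul_comm]
  · ring_nf
  · intro i hi
    have hi' : i < n := Finset.mem_range.1 hi
    have : (-γ - n - 1 + (γ + 2 + i) : ℝ) = -((n - i - 1 : ℕ) : ℝ) := by
      rw [Nat.sub_sub, Nat.cast_sub (by omega)]; push_cast; ring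
    rw [this, ascPochhammer_eval_neg_natCast (by omega)]
    ring

/-- The same point with `n + 1` in place of `n` leaves exactly the terms `i = n` and `i = n + 1`. -/
theorem eval_mellinPoly_subtop (γ : ℝ) (n : ℕ) (p : ℝ[X]) :
    (mellinPoly γ (n + 1) p).eval (-γ - n - 1) =
      (-1) ^ n * (ascPochhammer ℝ n).eval (γ + 1) * (p.coeff n - γ * p.coeff (n + 1)) := by
  rw [eval_mellinPoly, Finset.sum_range_succ, Finset.sum_range_succ, Finset.sum_eq_zero, zero_add,
    Nat.sub_self, ascPochhammer_zero, eval_one, mul_one, ← ascPochhammer_eval_one_sub_sub,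
    Nat.add_sub_cancel_left, ascPochhammer_one, eval_X, ascPochhammer_succ_eval,
    show (-γ - n - 1 + 1 : ℝ) = 1 - (γ + 1) - n by ring]
  · ring
  · intro i hi
    have hi' : i < n := Finset.mem_range.1 hi
    have : (-γ - n - 1 + (γ + 2 + i) : ℝ) = -((n - i - 1 : ℕ) : ℝ) := by
      rw [Nat.sub_sub, Nat.cast_sub (by omega)]; push_cast; ring
    rw [this, ascPochhammer_eval_neg_natCast (by omega)]
    ring

theorem eq_C_mul_prod_of_natDegree_le {P : ℝ[X]} {n : ℕ} (hP : P.natDegree ≤ n) {e : ℕ → ℝ}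
    (he : Function.Injective e) (h : ∀ j < n, P.eval (e j) = 0) :
    ∃ c, P = C c * ∏ j ∈ Finset.range n, (X - C (e j)) := by
  obtain ⟨q, hq⟩ : (∏ j ∈ Finset.range n, (X - C (e j))) ∣ P :=
    Finset.prod_dvd_of_coprime (fun i _ j _ hij => pairwise_coprime_X_sub_C he hij)
      fun j hj => dvd_iff_isRoot.2 (h j (Finset.mem_range.1 hj))
  have hm : (∏ j ∈ Finset.range n, (X - C (e j))).Monic := monic_prod_X_sub_C _ _
  refine ⟨q.coeff 0, ?_⟩
  have hd : q.natDegree = 0 := by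
    by_cases h0 : q = 0
    · simp [h0]
    · rw [hq, hm.natDegree_mul' h0, natDegree_finsetProd_X_sub_C_eq_card, Finset.card_range] at hP
      omega
  rw [← eq_C_of_natDegree_eq_zero hd, mul_comm, ← hq]

/-- The Mellin polynomial would have more zeros than its degree allows, so it vanishes; its value at
the top point then makes the leading coefficient of `p` zero. -/
theorem eq_zero_of_pairing_eq_zero {α β γ : ℝ} (hα : -1 < α) (hβ : -1 < β) (hγ : -1 < γ)
    (he : Function.Injective (exponent α β)) {n : ℕ} {p : ℝ[X]} (hp : p.degree < n)
    (h : ∀ j < n, pairing α β γ p (X ^ j) = 0) : p = 0 := by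
  by_contra h0
  have hd : p.natDegree < n := (natDegree_lt_iff_degree_lt h0).2 hp
  have hz : mellinPoly γ p.natDegree p = 0 := by
    refine eq_zero_of_natDegree_lt_card_of_eval_eq_zero' _
      ((Finset.range n).image (exponent α β)) ?_ ?_
    · intro s hs
      obtain ⟨j, hj, rfl⟩ := Finset.mem_image.1 hs
      exact (eval_mellinPoly_eq_zero_iff hα hβ hγ le_rfl j).2 (h j (Finset.mem_range.1 hj))
    · rw [Finset.card_image_of_injective _ he, Finset.card_range]
      exact (natDegree_mellinPoly_le _ _ _).trans_lt hd
  have := eval_mellinPoly_top γ p.natDegree p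
  rw [hz, eval_zero, coeff_natDegree] at this
  have h2 := (ascPochhammer_pos p.natDegree (γ + 1) (by linarith)).ne'
  simp [h2, h0] at this

/-! ### Normalization constants and subleading coefficients of type II polynomials -/

/-- `p` is monic of degree `n` and orthogonal to the first `n` weighted monomials. -/
structure IsMonicOrthogonal (α β γ : ℝ) (n : ℕ) (p : ℝ[X]) : Prop where
  monic : p.Monic
  natDegree_eq : p.natDegree = n
  pairing_eq_zero : ∀ j < n, pairing α β γ p (X ^ j) = 0

section

variable {α β γ : ℝ}

theorem gamma_add_exponent_pos (hα : -1 < α) (hβ : -1 < β) (hγ : -1 < γ) (n j : ℕ) :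
    0 < γ + (n + 1 : ℕ) + 1 + exponent α β j := by
  have := neg_one_lt_exponent hα hβ j
  have h0 : (0 : ℝ) ≤ n := Nat.cast_nonneg _
  push_cast; linarith

theorem prod_gamma_add_exponent_pos (hα : -1 < α) (hβ : -1 < β) (hγ : -1 < γ) (n : ℕ) :
    0 < ∏ j ∈ Finset.range n, (γ + n + 1 + exponent α β j) := by
  -- For `n = 0` the factors may be negative, but the product is empty.
  cases n with
  | zero => simp
  | succ n => exact Finset.prod_pos fun j _ => gamma_add_exponent_pos hα hβ hγ n j

theorem prod_range_neg (n : ℕ) (f : ℕ → ℝ) :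
    ∏ j ∈ Finset.range n, -f j = (-1) ^ n * ∏ j ∈ Finset.range n, f j := by
  rw [Finset.prod_neg, Finset.card_range]

theorem IsMonicOrthogonal.exists_mellinPoly_eq (hα : -1 < α) (hβ : -1 < β) (hγ : -1 < γ)
    (he : Function.Injective (exponent α β)) {n : ℕ} {p : ℝ[X]}
    (hp : IsMonicOrthogonal α β γ n p) :
    ∃ c, mellinPoly γ n p = C c * ∏ j ∈ Finset.range n, (X - C (exponent α β j)) ∧
      c * ∏ j ∈ Finset.range n, (γ + n + 1 + exponent α β j) =
        (ascPochhammer ℝ n).eval (γ + 1) := by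
  obtain ⟨c, hc⟩ := eq_C_mul_prod_of_natDegree_le (natDegree_mellinPoly_le γ n p) he
    fun j hj => (eval_mellinPoly_eq_zero_iff hα hβ hγ hp.natDegree_eq.le j).2
      (hp.pairing_eq_zero j hj)
  refine ⟨c, hc, ?_⟩
  have h := eval_mellinPoly_top γ n p
  have hn : p.coeff n = 1 := by rw [← hp.natDegree_eq]; exact hp.monic
  have hprod : ∏ j ∈ Finset.range n, (-γ - n - 1 - exponent α β j) =
      (-1) ^ n * ∏ j ∈ Finset.range n, (γ + n + 1 + exponent α β j) := by
    rw [← prod_range_neg]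
    exact Finset.prod_congr rfl fun j _ => by ring
  rw [hc, hn, eval_mul, eval_C, eval_prod] at h
  simp only [eval_sub, eval_X, eval_C] at h
  rw [hprod, mul_one] at h
  refine mul_left_cancel₀ (pow_ne_zero n (by norm_num : (-1 : ℝ) ≠ 0)) ?_
  linear_combination h

/-- The sign of the normalization constants of the type II polynomials. -/
theorem IsMonicOrthogonal.pairing_mul_prod_pos (hα : -1 < α) (hβ : -1 < β) (hγ : -1 < γ)
    (he : Function.Injective (exponent α β)) {n : ℕ} {p : ℝ[X]}
    (hp : IsMonicOrthogonal α β γ n p) :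
    0 < pairing α β γ p (X ^ n) *
      ∏ j ∈ Finset.range n, (exponent α β n - exponent α β j) := by
  obtain ⟨c, hc, hc'⟩ := hp.exists_mellinPoly_eq hα hβ hγ he
  have hcpos : 0 < c := by
    have h1 := ascPochhammer_pos n (γ + 1) (by linarith)
    rw [← hc'] at h1
    exact pos_of_mul_pos_left h1 (prod_gamma_add_exponent_pos hα hβ hγ n).le
  have h := pairing_mul_ascPochhammer hα hβ hγ hp.natDegree_eq.le n
  have h1 := ascPochhammer_exponent_pos hα hβ hγ n n
  have h2 := realMoment_pos hγ (neg_one_lt_exponent hα hβ n)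
  rw [hc, eval_mul, eval_C, eval_prod] at h
  simp only [eval_sub, eval_X, eval_C] at h
  have h3 : (∏ j ∈ Finset.range n, (exponent α β n - exponent α β j)) ≠ 0 :=
    Finset.prod_ne_zero_iff.2 fun j hj => sub_ne_zero.2 fun heq =>
      (Finset.mem_range.1 hj).ne' (he heq)
  refine pos_of_mul_pos_left (b := (ascPochhammer ℝ n).eval (exponent α β n + γ + 2)) ?_ h1.le
  -- Multiplying the pairing by the product turns the product in the Mellin polynomial into a
  -- square.
  have h4 : 0 < (∏ j ∈ Finset.range n, (exponent α β n - exponent α β j)) ^ 2 := by positivity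
  have h5 : pairing α β γ p (X ^ n) *
      (∏ j ∈ Finset.range n, (exponent α β n - exponent α β j)) *
        (ascPochhammer ℝ n).eval (exponent α β n + γ + 2) =
      realMoment γ (exponent α β n) * c *
        (∏ j ∈ Finset.range n, (exponent α β n - exponent α β j)) ^ 2 := by
    linear_combination (∏ j ∈ Finset.range n, (exponent α β n - exponent α β j)) * h
  rw [h5]
  positivity

/-- The subleading coefficient of the type II polynomials. -/
theorem IsMonicOrthogonal.coeff_eq (hα : -1 < α) (hβ : -1 < β) (hγ : -1 < γ)
    (he : Function.Injective (exponent α β)) {n : ℕ} {p : ℝ[X]}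
    (hp : IsMonicOrthogonal α β γ (n + 1) p) :
    p.coeff n = γ - (γ + n + 1) * ∏ j ∈ Finset.range (n + 1),
      (1 - 1 / (γ + n + 2 + exponent α β j)) := by
  obtain ⟨c, hc, hc'⟩ := hp.exists_mellinPoly_eq hα hβ hγ he
  have h := eval_mellinPoly_subtop γ n p
  have hn : p.coeff (n + 1) = 1 := by rw [← hp.natDegree_eq]; exact hp.monic
  have hpos : ∀ j, γ + n + 2 + exponent α β j ≠ 0 := fun j => by
    have := gamma_add_exponent_pos hα hβ hγ n j
    push_cast at this; linarith
  have hprod : ∏ j ∈ Finset.range (n + 1), (-γ - n - 1 - exponent α β j) =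
      (-1) ^ (n + 1) * ((∏ j ∈ Finset.range (n + 1), (γ + n + 2 + exponent α β j)) *
        ∏ j ∈ Finset.range (n + 1), (1 - 1 / (γ + n + 2 + exponent α β j))) := by
    rw [← Finset.prod_mul_distrib, ← prod_range_neg]
    refine Finset.prod_congr rfl fun j _ => ?_
    have := hpos j
    field_simp
    ring
  have hcast : ∏ j ∈ Finset.range (n + 1), (γ + (n + 1 : ℕ) + 1 + exponent α β j) =
      ∏ j ∈ Finset.range (n + 1), (γ + n + 2 + exponent α β j) :=
    Finset.prod_congr rfl fun j _ => by push_cast; ring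
  rw [hc, hn, eval_mul, eval_C, eval_prod] at h
  simp only [eval_sub, eval_X, eval_C] at h
  rw [hprod] at h
  rw [hcast, ascPochhammer_succ_eval] at hc'
  refine mul_left_cancel₀ (mul_ne_zero (pow_ne_zero n (by norm_num : (-1 : ℝ) ≠ 0))
    (ascPochhammer_pos n (γ + 1) (by linarith)).ne') ?_
  rw [pow_succ] at h
  linear_combination -h - (-1) ^ n *
    (∏ j ∈ Finset.range (n + 1), (1 - 1 / (γ + n + 2 + exponent α β j))) * hc'

/-- The subleading coefficient decreases when both exponents are raised by one. -/
theorem coeff_le_coeff_of_shift (hα : -1 < α) (hβ : -1 < β) (hγ : -1 < γ)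
    (he : Function.Injective (exponent α β)) {n : ℕ} {p q : ℝ[X]}
    (hp : IsMonicOrthogonal α β γ (n + 1) p)
    (hq : IsMonicOrthogonal (α + 1) (β + 1) γ (n + 1) q) : q.coeff n ≤ p.coeff n := by
  have he' : Function.Injective (exponent (α + 1) (β + 1)) := fun i j h =>
    he (by simpa [exponent_shift] using h)
  rw [hp.coeff_eq hα hβ hγ he, hq.coeff_eq (by linarith) (by linarith) hγ he']
  have hn : (0 : ℝ) ≤ n := Nat.cast_nonneg _
  have key : ∀ j, 1 - 1 / (γ + n + 2 + exponent α β j) ≤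
      1 - 1 / (γ + n + 2 + exponent (α + 1) (β + 1) j) := fun j => by
    have := neg_one_lt_exponent hα hβ j
    rw [exponent_shift]
    gcongr
    · linarith
    · linarith
  have hprod : ∏ j ∈ Finset.range (n + 1), (1 - 1 / (γ + n + 2 + exponent α β j)) ≤
      ∏ j ∈ Finset.range (n + 1), (1 - 1 / (γ + n + 2 + exponent (α + 1) (β + 1) j)) := by
    -- For `n = 0` the only factor may be negative, so it is compared directly; for `n ≥ 1` all
    -- factors are nonnegative.
    rcases Nat.eq_zero_or_pos n with rfl | hpos
    · simpa using key 0
    · refine Finset.prod_le_prod (fun j _ => ?_) fun j _ => key j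
      have h1 : (1 : ℝ) ≤ n := by exact_mod_cast hpos
      have := neg_one_lt_exponent hα hβ j
      rw [sub_nonneg, div_le_one (by linarith)]
      linarith
  have := mul_le_mul_of_nonneg_left hprod (by linarith : 0 ≤ γ + n + 1)
  linarith

/-! ### Nonsingular moment matrices, existence and uniqueness -/

theorem pairing_sum_C_mul {l : ℕ} (a : Fin l → ℝ) (v : ℝ[X]) :
    pairing α β γ (∑ i : Fin l, C (a i) * X ^ (i : ℕ)) v =
      ∑ i : Fin l, a i * pairing α β γ (X ^ (i : ℕ)) v := by
  simp only [← smul_eq_C_mul, map_sum, map_smul, LinearMap.sum_apply, LinearMap.smul_apply,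
    smul_eq_mul]

/-- A left null vector is the coefficient vector of a polynomial of degree `< l` orthogonal to the
first `l` weighted monomials. -/
theorem det_momentTrunc_ne_zero (hα : -1 < α) (hβ : -1 < β) (hγ : -1 < γ)
    (he : Function.Injective (exponent α β)) (l : ℕ) : (momentTrunc α β γ l).det ≠ 0 := by
  intro hdet
  obtain ⟨v, hv, hv0⟩ := Matrix.exists_vecMul_eq_zero_iff.2 hdet
  refine hv ?_
  have hp : (∑ i : Fin l, C (v i) * X ^ (i : ℕ) : ℝ[X]) = 0 := by
    refine eq_zero_of_pairing_eq_zero hα hβ hγ he (n := l) ?_ fun j hj => ?_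
    · refine lt_of_le_of_lt (degree_sum_le _ _) ?_
      refine (Finset.sup_lt_iff (WithBot.bot_lt_coe l)).2 fun i _ => ?_
      exact lt_of_le_of_lt (degree_C_mul_X_pow_le _ _) (WithBot.coe_lt_coe.2 i.2)
    · have := congrFun hv0 ⟨j, hj⟩
      simp only [pairing_sum_C_mul, pairing_X_pow]
      simpa [Matrix.vecMul, dotProduct, momentTrunc] using this
  funext i
  have := congrArg (fun q => coeff q (i : ℕ)) hp
  simpa [finsetSum_coeff, coeff_X_pow, Fin.val_inj] using this

theorem isMonicOrthogonal_polyB (hα : -1 < α) (hβ : -1 < β) (hγ : -1 < γ)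
    (he : Function.Injective (exponent α β)) (l : ℕ) :
    IsMonicOrthogonal α β γ l (polyB α β γ l) := by
  refine ⟨monic_polyB α β γ l, natDegree_eq_of_degree_eq_some (degree_polyB α β γ l), ?_⟩
  intro j hj
  have hdet := (det_momentTrunc_ne_zero hα hβ hγ he l).isUnit
  have h : Matrix.vecMul (Matrix.vecMul (fun k : Fin l => moment α β γ l k)
      (momentTrunc α β γ l)⁻¹) (momentTrunc α β γ l) ⟨j, hj⟩ = moment α β γ l j := by
    rw [Matrix.vecMul_vecMul, Matrix.nonsing_inv_mul _ hdet, Matrix.vecMul_one]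
  rw [polyB, lowerPartB, map_sub, LinearMap.sub_apply, pairing_sum_C_mul, sub_eq_zero,
    pairing_X_pow, ← h]
  simp [pairing_X_pow, Matrix.vecMul, dotProduct, momentTrunc]

theorem IsMonicOrthogonal.unique (hα : -1 < α) (hβ : -1 < β) (hγ : -1 < γ)
    (he : Function.Injective (exponent α β)) {n : ℕ} {p q : ℝ[X]}
    (hp : IsMonicOrthogonal α β γ n p) (hq : IsMonicOrthogonal α β γ n q) : p = q := by
  rw [← sub_eq_zero]
  refine eq_zero_of_pairing_eq_zero hα hβ hγ he (n := n) ?_ fun j hj => ?_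
  · have hp' : p.degree = n := by rw [degree_eq_natDegree hp.monic.ne_zero, hp.natDegree_eq]
    have hq' : q.degree = n := by rw [degree_eq_natDegree hq.monic.ne_zero, hq.natDegree_eq]
    rw [← hp']
    exact degree_sub_lt_left (hp'.trans hq'.symm) hp.monic.ne_zero
      (hp.monic.leadingCoeff.trans hq.monic.leadingCoeff.symm)
  · rw [map_sub, LinearMap.sub_apply, hp.pairing_eq_zero j hj, hq.pairing_eq_zero j hj, sub_zero]

/-- The polynomial encoding the linear form `Q^{(l)}`. -/
def polyQ (α β γ : ℝ) (l : ℕ) : ℝ[X] :=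
  ∑ j : Fin (l + 1), C (coeffQ α β γ l j) * X ^ (j : ℕ)

theorem degree_polyQ_lt (α β γ : ℝ) (l : ℕ) :
    (polyQ α β γ l).degree < ((l + 1 : ℕ) : WithBot ℕ) := by
  refine lt_of_le_of_lt (degree_sum_le _ _) ?_
  refine (Finset.sup_lt_iff (WithBot.bot_lt_coe (l + 1))).2 fun i _ => ?_
  exact lt_of_le_of_lt (degree_C_mul_X_pow_le _ _) (WithBot.coe_lt_coe.2 i.2)

theorem pairing_X_pow_polyQ (hα : -1 < α) (hβ : -1 < β) (hγ : -1 < γ)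
    (he : Function.Injective (exponent α β)) {i l : ℕ} (hi : i ≤ l) :
    pairing α β γ (X ^ i) (polyQ α β γ l) = if i = l then 1 else 0 := by
  have hdet := (det_momentTrunc_ne_zero hα hβ hγ he (l + 1)).isUnit
  have h := congrFun (congrFun (Matrix.mul_nonsing_inv _ hdet) ⟨i, Nat.lt_succ_of_le hi⟩)
    (Fin.last l)
  simp only [polyQ, ← smul_eq_C_mul, map_sum, map_smul, pairing_X_pow]
  rw [Matrix.mul_apply, Matrix.one_apply] at h
  simp only [Fin.ext_iff, Fin.val_last] at h
  rw [← h]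
  exact Finset.sum_congr rfl fun j _ => by simp [coeffQ, momentTrunc, mul_comm]

theorem eq_zero_of_pairing_X_pow_eq_zero (hα : -1 < α) (hβ : -1 < β) (hγ : -1 < γ)
    (he : Function.Injective (exponent α β)) {n : ℕ} {v : ℝ[X]} (hv : v.degree < n)
    (h : ∀ i < n, pairing α β γ (X ^ i) v = 0) : v = 0 := by
  have hsum : v = ∑ j : Fin n, C (v.coeff j) * X ^ (j : ℕ) := by
    by_cases h0 : v = 0
    · simp [h0]
    · conv_lhs => rw [v.as_sum_range_C_mul_X_pow' ((natDegree_lt_iff_degree_lt h0).2 hv)]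
      rw [Finset.sum_range]
  have hz : (fun j : Fin n => v.coeff j) = 0 := by
    refine Matrix.eq_zero_of_mulVec_eq_zero (det_momentTrunc_ne_zero hα hβ hγ he n) ?_
    funext i
    have h1 := h i i.2
    rw [hsum] at h1
    simp only [← smul_eq_C_mul, map_sum, map_smul, pairing_X_pow] at h1
    simpa [Matrix.mulVec, dotProduct, momentTrunc, mul_comm] using h1
  rw [hsum]
  exact Finset.sum_eq_zero fun j _ => by simp [show v.coeff j = 0 from congrFun hz j]

end

/-! ### Connection with the shifted exponents and the nonnegative recurrence -/

section

variable {α β γ : ℝ}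

theorem IsMonicOrthogonal.degree_eq {n : ℕ} {p : ℝ[X]} (hp : IsMonicOrthogonal α β γ n p) :
    p.degree = n := by
  rw [degree_eq_natDegree hp.monic.ne_zero, hp.natDegree_eq]

theorem IsMonicOrthogonal.coeff_self {n : ℕ} {p : ℝ[X]} (hp : IsMonicOrthogonal α β γ n p) :
    p.coeff n = 1 := by
  rw [← hp.natDegree_eq]; exact hp.monic

theorem IsMonicOrthogonal.degree_sub_C_mul_lt {n : ℕ} {p q : ℝ[X]}
    (hq : IsMonicOrthogonal α β γ n q) (hp : p.degree < ((n + 1 : ℕ) : WithBot ℕ)) :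
    (p - C (p.coeff n) * q).degree < n := by
  rw [degree_lt_iff_coeff_zero]
  intro m hm
  rcases hm.eq_or_lt with rfl | hlt
  · simp [hq.coeff_self]
  · rw [coeff_sub, coeff_C_mul, coeff_eq_zero_of_degree_lt (hp.trans_le (by exact_mod_cast hlt)),
      coeff_eq_zero_of_degree_lt (hq.degree_eq.trans_lt (by exact_mod_cast hlt))]
    simp

theorem pairing_C_mul (a : ℝ) (p v : ℝ[X]) :
    pairing α β γ (C a * p) v = a * pairing α β γ p v := by
  rw [← smul_eq_C_mul, map_smul, LinearMap.smul_apply, smul_eq_mul]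

theorem IsMonicOrthogonal.eq_C_mul (hα : -1 < α) (hβ : -1 < β) (hγ : -1 < γ)
    (he : Function.Injective (exponent α β)) {n : ℕ} {p q : ℝ[X]}
    (hq : IsMonicOrthogonal α β γ n q) (hp : p.degree < ((n + 1 : ℕ) : WithBot ℕ))
    (h : ∀ j < n, pairing α β γ p (X ^ j) = 0) : p = C (p.coeff n) * q := by
  rw [← sub_eq_zero]
  refine eq_zero_of_pairing_eq_zero hα hβ hγ he (hq.degree_sub_C_mul_lt hp) fun j hj => ?_
  rw [map_sub, LinearMap.sub_apply, pairing_C_mul, h j hj, hq.pairing_eq_zero j hj]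
  ring

theorem injective_exponent_shift (he : Function.Injective (exponent α β)) :
    Function.Injective (exponent (α + 1) (β + 1)) := fun i j h =>
  he (by simpa [exponent_shift] using h)

/-- By `pairing_shift`, `X * B'_n` is orthogonal to the first `n` weighted monomials, so after
subtracting `B_{n+1}` only a multiple of `B_n` is left. -/
theorem exists_X_mul_shift_eq (hα : -1 < α) (hβ : -1 < β) (hγ : -1 < γ)
    (he : Function.Injective (exponent α β)) (n : ℕ) :
    ∃ d : ℝ, 0 ≤ d ∧
      X * polyB (α + 1) (β + 1) γ n = polyB α β γ (n + 1) + C d * polyB α β γ n := by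
  have he' := injective_exponent_shift he
  have hB := isMonicOrthogonal_polyB hα hβ hγ he
  have hB' := isMonicOrthogonal_polyB (by linarith : -1 < α + 1) (by linarith : -1 < β + 1) hγ he' n
  have hm : (X * polyB (α + 1) (β + 1) γ n).Monic := monic_X.mul hB'.monic
  have hdeg : (X * polyB (α + 1) (β + 1) γ n).degree = ((n + 1 : ℕ) : WithBot ℕ) := by
    rw [degree_mul, degree_X, hB'.degree_eq]; push_cast; ring
  have hlt : (X * polyB (α + 1) (β + 1) γ n - polyB α β γ (n + 1)).degree <
      ((n + 1 : ℕ) : WithBot ℕ) := by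
    have := degree_sub_lt_left (hdeg.trans (hB (n + 1)).degree_eq.symm) hm.ne_zero
      (hm.leadingCoeff.trans (hB (n + 1)).monic.leadingCoeff.symm)
    rwa [hdeg] at this
  have heq := (hB n).eq_C_mul hα hβ hγ he hlt fun j hj => by
    rw [map_sub, LinearMap.sub_apply, ← pairing_shift, hB'.pairing_eq_zero j hj,
      (hB (n + 1)).pairing_eq_zero j (by omega), sub_zero]
  set d := (X * polyB (α + 1) (β + 1) γ n - polyB α β γ (n + 1)).coeff n
  refine ⟨d, ?_, by rw [← heq]; ring⟩
  -- Pairing with `X ^ n` shows that `d` is the quotient of the normalization constants of `B'_n`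
  -- and `B_n`. They have the same sign, since the shift preserves differences of exponents.
  have h1 := congrArg (fun p => pairing α β γ p (X ^ n)) heq
  simp only [map_sub, LinearMap.sub_apply] at h1
  rw [← pairing_shift, (hB (n + 1)).pairing_eq_zero n (by omega), sub_zero, pairing_C_mul] at h1
  have h2 := (hB n).pairing_mul_prod_pos hα hβ hγ he
  have h3 := hB'.pairing_mul_prod_pos (by linarith) (by linarith) hγ he'
  simp only [exponent_shift, add_sub_add_right_eq_sub] at h3
  rw [h1, mul_assoc] at h3
  exact (pos_of_mul_pos_left h3 h2.le).le

theorem polyB_zero : polyB α β γ 0 = 1 := by simp [polyB, lowerPartB]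

theorem exists_polyB_one_eq (hα : -1 < α) (hβ : -1 < β) (hγ : -1 < γ)
    (he : Function.Injective (exponent α β)) :
    ∃ l : ℝ, 0 ≤ l ∧ polyB α β γ 1 = polyB (α + 1) (β + 1) γ 1 + C l := by
  have hB := isMonicOrthogonal_polyB hα hβ hγ he 1
  have hB' := isMonicOrthogonal_polyB (by linarith : -1 < α + 1) (by linarith : -1 < β + 1) hγ
    (injective_exponent_shift he) 1
  refine ⟨_, sub_nonneg.2 (coeff_le_coeff_of_shift hα hβ hγ he hB hB'), ?_⟩
  have h1 := hB.monic.eq_X_add_C hB.natDegree_eq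
  have h2 := hB'.monic.eq_X_add_C hB'.natDegree_eq
  rw [C_sub]
  nth_rw 1 [h1]
  nth_rw 1 [h2]
  ring

/-- Here `|α - β| < 1` makes every later exponent exceed the first two; only the order of those two
depends on the sign of `α - β`. -/
theorem sub_exponent_pos (hlt : |α - β| < 1) (n : ℕ) :
    0 < exponent α β (n + 2) - exponent α β 0 ∧ 0 < exponent α β (n + 2) - exponent α β 1 := by
  have h := abs_lt.1 hlt
  have h0 : (0 : ℝ) ≤ ((n / 2 : ℕ) : ℝ) := Nat.cast_nonneg _
  rw [exponent_add_two]
  simp only [exponent]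
  constructor <;> split_ifs <;> simp_all <;> linarith

/-- For the shifted exponents the `j`-th weighted monomial is the old one of index `j + 2`, so
`B_{n+2}` remains orthogonal to the first `n` of them. -/
theorem exists_polyB_add_two_eq (hα : -1 < α) (hβ : -1 < β) (hγ : -1 < γ)
    (he : Function.Injective (exponent α β)) (hlt : |α - β| < 1) (n : ℕ) :
    ∃ l₁ l₂ : ℝ, 0 ≤ l₁ ∧ 0 ≤ l₂ ∧ polyB α β γ (n + 2) = polyB (α + 1) (β + 1) γ (n + 2) +
      C l₁ * polyB (α + 1) (β + 1) γ (n + 1) + C l₂ * polyB (α + 1) (β + 1) γ n := by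
  have he' := injective_exponent_shift he
  have hα' : -1 < α + 1 := by linarith
  have hβ' : -1 < β + 1 := by linarith
  have hB := isMonicOrthogonal_polyB hα hβ hγ he (n + 2)
  have hB' := isMonicOrthogonal_polyB hα' hβ' hγ he'
  have horth : ∀ j, pairing (α + 1) (β + 1) γ (polyB α β γ (n + 2)) (X ^ j) =
      pairing α β γ (polyB α β γ (n + 2)) (X ^ (j + 2)) := fun j => by
    rw [pairing_shift, pairing_X_mul, ← pow_add, add_comm 2]
  have hd1 : (polyB α β γ (n + 2) - polyB (α + 1) (β + 1) γ (n + 2)).degree <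
      ((n + 1 + 1 : ℕ) : WithBot ℕ) := by
    have := degree_sub_lt_left (hB.degree_eq.trans (hB' (n + 2)).degree_eq.symm) hB.monic.ne_zero
      (hB.monic.leadingCoeff.trans (hB' (n + 2)).monic.leadingCoeff.symm)
    rwa [hB.degree_eq] at this
  have hd2 := (hB' (n + 1)).degree_sub_C_mul_lt hd1
  have heq := (hB' n).eq_C_mul hα' hβ' hγ he' hd2 fun j hj => by
    rw [map_sub, map_sub, LinearMap.sub_apply, LinearMap.sub_apply, pairing_C_mul, horth,
      hB.pairing_eq_zero _ (by omega), (hB' (n + 2)).pairing_eq_zero j (by omega),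
      (hB' (n + 1)).pairing_eq_zero j (by omega)]
    ring
  set l₁ := (polyB α β γ (n + 2) - polyB (α + 1) (β + 1) γ (n + 2)).coeff (n + 1) with hl₁
  set l₂ := (polyB α β γ (n + 2) - polyB (α + 1) (β + 1) γ (n + 2) -
    C l₁ * polyB (α + 1) (β + 1) γ (n + 1)).coeff n
  refine ⟨l₁, l₂, ?_, ?_, by rw [← heq]; ring⟩
  · rw [hl₁, coeff_sub, sub_nonneg]
    exact coeff_le_coeff_of_shift hα hβ hγ he hB (hB' (n + 2))
  · have h1 := congrArg (fun p => pairing (α + 1) (β + 1) γ p (X ^ n)) heq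
    simp only [map_sub, LinearMap.sub_apply] at h1
    rw [pairing_C_mul, pairing_C_mul, horth, (hB' (n + 2)).pairing_eq_zero n (by omega),
      (hB' (n + 1)).pairing_eq_zero n (by omega), mul_zero, sub_zero, sub_zero] at h1
    have h2 := (hB' n).pairing_mul_prod_pos hα' hβ' hγ he'
    have h3 := hB.pairing_mul_prod_pos hα hβ hγ he
    simp only [exponent_shift, add_sub_add_right_eq_sub] at h2
    -- With the factors `j = 0, 1` split off, the sign product of order `n + 2` becomes that of
    -- order `n`, because `e (j + 2) = e j + 1`. So `l₂`, the quotient of the two normalization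
    -- constants, is positive.
    rw [Finset.prod_range_succ', Finset.prod_range_succ'] at h3
    simp only [add_assoc, one_add_one_eq_two, zero_add] at h3
    rw [Finset.prod_congr rfl fun j _ => show exponent α β (n + 2) - exponent α β (j + 2) =
      exponent α β n - exponent α β j by rw [exponent_add_two, exponent_add_two]; ring, h1] at h3
    obtain ⟨h4, h5⟩ := sub_exponent_pos hlt n
    rw [show ∀ l H P a b : ℝ, l * H * (P * a * b) = l * (H * P * (b * a)) by intros; ring] at h3
    exact (pos_of_mul_pos_left h3 (mul_pos h2 (mul_pos h4 h5)).le).le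

/-- The recurrence relation of the type II polynomials has nonnegative coefficients. -/
theorem exists_X_mul_polyB_eq (hα : -1 < α) (hβ : -1 < β) (hγ : -1 < γ)
    (he : Function.Injective (exponent α β)) (hlt : |α - β| < 1) (n : ℕ) :
    ∃ a b c : ℝ, 0 ≤ a ∧ 0 ≤ b ∧ 0 ≤ c ∧ X * polyB α β γ n = polyB α β γ (n + 1) +
      C a * polyB α β γ n + C b * polyB α β γ (n - 1) + C c * polyB α β γ (n - 2) := by
  choose d hd hdB using exists_X_mul_shift_eq hα hβ hγ he
  -- For `n < 2` the truncated indices `n - 1`, `n - 2` may repeat; the coefficients of the absent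
  -- terms are taken to be zero.
  rcases n with _ | _ | n
  · refine ⟨d 0, 0, 0, hd 0, le_rfl, le_rfl, ?_⟩
    have h := hdB 0
    rw [polyB_zero] at h
    rw [polyB_zero, h, polyB_zero, C_0]
    ring
  · obtain ⟨l, hl, h⟩ := exists_polyB_one_eq hα hβ hγ he
    refine ⟨d 1 + l, l * d 0, 0, add_nonneg (hd 1) hl, mul_nonneg hl (hd 0), le_rfl, ?_⟩
    have h0 := hdB 0
    rw [polyB_zero] at h0
    have h1 := hdB 1
    simp only [zero_add, Nat.sub_self, C_add, C_mul, C_0] at *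
    nth_rw 1 [h]
    rw [mul_add, h1]
    linear_combination C l * h0
  · obtain ⟨l₁, l₂, hl₁, hl₂, h⟩ := exists_polyB_add_two_eq hα hβ hγ he hlt n
    refine ⟨d (n + 2) + l₁, l₁ * d (n + 1) + l₂, l₂ * d n, add_nonneg (hd _) hl₁,
      add_nonneg (mul_nonneg hl₁ (hd _)) hl₂, mul_nonneg hl₂ (hd _), ?_⟩
    have h0 := hdB n
    have h1 := hdB (n + 1)
    have h2 := hdB (n + 2)
    simp only [add_assoc, Nat.reduceAdd, Nat.add_sub_cancel, C_add, C_mul,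
      show n + 2 - 1 = n + 1 by omega] at *
    nth_rw 1 [h]
    linear_combination h2 + C l₁ * h1 + C l₂ * h0

/-! ### Entries of the Jacobi matrix -/

theorem repr_polyB (m : ℕ) :
    ((seqB α β γ).basis (isUnit_leadingCoeff_seqB α β γ)).repr (polyB α β γ m) =
      Finsupp.single m 1 := by
  rw [show polyB α β γ m = (seqB α β γ).basis (isUnit_leadingCoeff_seqB α β γ) m from
    ((seqB α β γ).basis_eq_self _ m).symm, Module.Basis.repr_self]

theorem exists_jacobiMatrix_eq (hα : -1 < α) (hβ : -1 < β) (hγ : -1 < γ)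
    (he : Function.Injective (exponent α β)) (hlt : |α - β| < 1) (n : ℕ) :
    ∃ a b c : ℝ, 0 ≤ a ∧ 0 ≤ b ∧ 0 ≤ c ∧ ∀ m, jacobiMatrix α β γ n m =
      (if n + 1 = m then 1 else 0) + (if n = m then a else 0) + (if n - 1 = m then b else 0) +
        (if n - 2 = m then c else 0) := by
  obtain ⟨a, b, c, ha, hb, hc, h⟩ := exists_X_mul_polyB_eq hα hβ hγ he hlt n
  refine ⟨a, b, c, ha, hb, hc, fun m => ?_⟩
  simp only [jacobiMatrix, Matrix.of_apply, h, ← smul_eq_C_mul, map_add, map_smul, repr_polyB]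
  simp [Finsupp.single_apply]

theorem jacobiMatrix_nonneg (hα : -1 < α) (hβ : -1 < β) (hγ : -1 < γ)
    (he : Function.Injective (exponent α β)) (hlt : |α - β| < 1) (n m : ℕ) :
    0 ≤ jacobiMatrix α β γ n m := by
  obtain ⟨a, b, c, ha, hb, hc, h⟩ := exists_jacobiMatrix_eq hα hβ hγ he hlt n
  rw [h]
  positivity

theorem jacobiMatrix_succ (hα : -1 < α) (hβ : -1 < β) (hγ : -1 < γ)
    (he : Function.Injective (exponent α β)) (hlt : |α - β| < 1) (n : ℕ) :
    jacobiMatrix α β γ n (n + 1) = 1 := by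
  obtain ⟨a, b, c, -, -, -, h⟩ := exists_jacobiMatrix_eq hα hβ hγ he hlt n
  rw [h, if_pos rfl, if_neg (by omega), if_neg (by omega), if_neg (by omega)]
  ring

theorem jacobiMatrix_eq_zero (hα : -1 < α) (hβ : -1 < β) (hγ : -1 < γ)
    (he : Function.Injective (exponent α β)) (hlt : |α - β| < 1) {n m : ℕ}
    (hnm : n + 1 < m ∨ m + 2 < n) : jacobiMatrix α β γ n m = 0 := by
  obtain ⟨a, b, c, -, -, -, h⟩ := exists_jacobiMatrix_eq hα hβ hγ he hlt n
  rw [h, if_neg (by omega), if_neg (by omega), if_neg (by omega), if_neg (by omega)]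
  ring

/-! ### Biorthogonality -/

theorem pairing_eq_zero_of_degree_lt {n : ℕ} {p v : ℝ[X]} (hp : IsMonicOrthogonal α β γ n p)
    (hv : v.degree < n) : pairing α β γ p v = 0 := by
  by_cases h0 : v = 0
  · simp [h0]
  rw [v.as_sum_range_C_mul_X_pow' ((natDegree_lt_iff_degree_lt h0).2 hv), map_sum]
  refine Finset.sum_eq_zero fun j hj => ?_
  rw [← smul_eq_C_mul, map_smul, hp.pairing_eq_zero j (Finset.mem_range.1 hj), smul_zero]

theorem pairing_polyB_polyQ (hα : -1 < α) (hβ : -1 < β) (hγ : -1 < γ)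
    (he : Function.Injective (exponent α β)) (m n : ℕ) :
    pairing α β γ (polyB α β γ m) (polyQ α β γ n) = if m = n then 1 else 0 := by
  rcases lt_or_ge n m with h | h
  · rw [if_neg h.ne', pairing_eq_zero_of_degree_lt (isMonicOrthogonal_polyB hα hβ hγ he m)]
    exact (degree_polyQ_lt α β γ n).trans_le (by exact_mod_cast h)
  · rw [polyB, lowerPartB, map_sub, LinearMap.sub_apply, pairing_sum_C_mul,
      pairing_X_pow_polyQ hα hβ hγ he h, Finset.sum_eq_zero, sub_zero]
    intro i _
    rw [pairing_X_pow_polyQ hα hβ hγ he (i.2.le.trans h), if_neg (i.2.trans_le h).ne, mul_zero]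

theorem repr_eq_pairing (hα : -1 < α) (hβ : -1 < β) (hγ : -1 < γ)
    (he : Function.Injective (exponent α β)) (p : ℝ[X]) (n : ℕ) :
    ((seqB α β γ).basis (isUnit_leadingCoeff_seqB α β γ)).repr p n =
      pairing α β γ p (polyQ α β γ n) := by
  set b := (seqB α β γ).basis (isUnit_leadingCoeff_seqB α β γ) with hb
  have : b.coord n = (pairing α β γ).flip (polyQ α β γ n) := by
    refine b.ext fun m => ?_
    rw [Module.Basis.coord_apply, Module.Basis.repr_self, LinearMap.flip_apply,
      show b m = polyB α β γ m from (seqB α β γ).basis_eq_self _ m,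
      pairing_polyB_polyQ hα hβ hγ he, Finsupp.single_apply]
  exact LinearMap.congr_fun this p

/-- For `k ≥ n` the pairing with `B_k` vanishes by orthogonality, so `v` pairs to zero with a whole
basis. -/
theorem eq_zero_of_pairing_polyB_eq_zero (hα : -1 < α) (hβ : -1 < β) (hγ : -1 < γ)
    (he : Function.Injective (exponent α β)) {n : ℕ} {v : ℝ[X]} (hv : v.degree < n)
    (h : ∀ k < n, pairing α β γ (polyB α β γ k) v = 0) : v = 0 := by
  have hz : (pairing α β γ).flip v = 0 := by
    refine ((seqB α β γ).basis (isUnit_leadingCoeff_seqB α β γ)).ext fun k => ?_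
    rw [(seqB α β γ).basis_eq_self _ k, LinearMap.flip_apply, LinearMap.zero_apply]
    rcases lt_or_ge k n with hk | hk
    · exact h k hk
    · exact pairing_eq_zero_of_degree_lt (isMonicOrthogonal_polyB hα hβ hγ he k)
        (hv.trans_le (by exact_mod_cast hk))
  exact eq_zero_of_pairing_X_pow_eq_zero hα hβ hγ he hv fun i _ => LinearMap.congr_fun hz (X ^ i)

/-- The dual recurrence, satisfied by the type I linear forms. -/
theorem X_sq_mul_polyQ (hα : -1 < α) (hβ : -1 < β) (hγ : -1 < γ)
    (he : Function.Injective (exponent α β)) (n : ℕ) :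
    X ^ 2 * polyQ α β γ n =
      ∑ m ∈ Finset.range (n + 3), C (jacobiMatrix α β γ m n) * polyQ α β γ m := by
  rw [← sub_eq_zero]
  refine eq_zero_of_pairing_polyB_eq_zero hα hβ hγ he (n := n + 3) ?_ fun k hk => ?_
  · refine lt_of_le_of_lt (degree_sub_le _ _) (max_lt ?_ ?_)
    · rw [degree_lt_iff_coeff_zero]
      intro m hm
      obtain ⟨m, rfl⟩ := Nat.exists_eq_add_of_le' (show 2 ≤ m by omega)
      rw [coeff_X_pow_mul]
      exact coeff_eq_zero_of_degree_lt ((degree_polyQ_lt α β γ n).trans_le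
        (by exact_mod_cast (by omega : n + 1 ≤ m)))
    · refine lt_of_le_of_lt (degree_sum_le _ _)
        ((Finset.sup_lt_iff (WithBot.bot_lt_coe _)).2 fun m hm => ?_)
      rw [← smul_eq_C_mul]
      refine lt_of_le_of_lt (degree_smul_le _ _) ((degree_polyQ_lt α β γ m).trans_le ?_)
      exact_mod_cast Finset.mem_range.1 hm
  -- Moving `X ^ 2` across as `X` turns the left side into the `n`-th coordinate of `X * B_k`, that
  -- is, `J_{k,n}`.
  · simp only [map_sub, map_sum, ← smul_eq_C_mul, map_smul, pairing_polyB_polyQ hα hβ hγ he,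
      ← pairing_X_mul, ← repr_eq_pairing hα hβ hγ he]
    simp [hk, jacobiMatrix]

end

/-! ### Zeros of generalized polynomials with real exponents -/

theorem hasDerivAt_sum_rpow (s : Finset ℕ) (c e : ℕ → ℝ) {x : ℝ} (hx : 0 < x) :
    HasDerivAt (fun x => ∑ j ∈ s, c j * x ^ e j) (∑ j ∈ s, c j * e j * x ^ (e j - 1)) x := by
  refine HasDerivAt.fun_sum fun j _ => ?_
  simpa only [mul_assoc] using (Real.hasDerivAt_rpow_const (Or.inl hx.ne')).const_mul (c j)

/-- Rolle's theorem: if the zeros of `f'` on `(0, ∞)` lie in a finite set, the zeros of `f` on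
`(0, ∞)` lie in a finite set with at most one more element. -/
theorem exists_finset_zeros_of_deriv {f f' : ℝ → ℝ} (hf : ∀ x, 0 < x → HasDerivAt f (f' x) x)
    (t : Finset ℝ) (ht : ∀ x, 0 < x → f' x = 0 → x ∈ t) :
    ∃ u : Finset ℝ, u.card ≤ t.card + 1 ∧ ∀ x, 0 < x → f x = 0 → x ∈ u := by
  have hcard : ∀ u : Finset ℝ, (↑u ⊆ {x : ℝ | 0 < x ∧ f x = 0}) → u.card ≤ t.card + 1 := by
    intro u hu
    refine Finset.card_le_of_interleaved fun x hx y hy hxy _ => ?_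
    obtain ⟨hx0, hfx⟩ := hu hx
    obtain ⟨-, hfy⟩ := hu hy
    obtain ⟨z, hz, hz'⟩ := exists_hasDerivAt_eq_zero hxy
      (fun w hw => (hf w (hx0.trans_le hw.1)).continuousAt.continuousWithinAt)
      (hfx.trans hfy.symm) fun w hw => hf w (hx0.trans hw.1)
    exact ⟨z, ht z (hx0.trans hz.1) hz', hz⟩
  have hfin : {x : ℝ | 0 < x ∧ f x = 0}.Finite := by
    by_contra hinf
    obtain ⟨u, hu, hu'⟩ := Set.Infinite.exists_subset_card_eq hinf (t.card + 2)
    have := hcard u hu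
    omega
  exact ⟨hfin.toFinset, hcard _ (by simp), fun x hx hfx => by simp [hx, hfx]⟩

/-- A generalized polynomial with `n` terms has fewer than `n` zeros on `(0, ∞)`. -/
theorem exists_finset_zeros_sum_rpow (s : Finset ℕ) : s.Nonempty → ∀ c e : ℕ → ℝ,
    Function.Injective e → (∀ j ∈ s, c j ≠ 0) →
    ∃ t : Finset ℝ, t.card < s.card ∧ ∀ x, 0 < x → ∑ j ∈ s, c j * x ^ e j = 0 → x ∈ t := by
  induction s using Finset.induction_on with
  | empty => intro h; exact absurd h Finset.not_nonempty_empty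
  | insert i s hi ih =>
    intro _ c e he hc
    rcases s.eq_empty_or_nonempty with rfl | hs
    · refine ⟨∅, by simp, fun x hx h => ?_⟩
      have hci := hc i (by simp)
      simp [hci, (Real.rpow_pos_of_pos hx (e i)).ne'] at h
    -- Division by `x ^ e i` makes the `i`-th term constant and differentiation removes it; these
    -- are the coefficients and exponents of the remaining terms.
    · obtain ⟨t, htc, ht⟩ := ih hs (fun j => c j * (e j - e i)) (fun j => e j - e i - 1)
        (fun j k h => he (by simpa using h)) fun j hj => mul_ne_zero
          (hc j (Finset.mem_insert_of_mem hj)) (sub_ne_zero.2 fun h => hi (he h ▸ hj))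
      obtain ⟨u, huc, hu⟩ := exists_finset_zeros_of_deriv
        (fun x hx => hasDerivAt_sum_rpow (insert i s) c (fun j => e j - e i) hx) t
        fun x hx h => ht x hx (by rw [Finset.sum_insert hi] at h; simpa using h)
      refine ⟨u, by rw [Finset.card_insert_of_notMem hi]; omega, fun x hx h => hu x hx ?_⟩
      have : ∀ j, c j * x ^ (e j - e i) = c j * x ^ e j * (x ^ e i)⁻¹ := fun j => by
        rw [Real.rpow_sub hx]; ring
      simp only [this]
      rw [← Finset.sum_mul, h, zero_mul]

/-! ### Sign changes -/

theorem pos_or_neg_of_ne_zero {f : ℝ → ℝ} {s : Set ℝ} (hs : IsPreconnected s)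
    (hf : ContinuousOn f s) (h : ∀ x ∈ s, f x ≠ 0) :
    (∀ x ∈ s, 0 < f x) ∨ (∀ x ∈ s, f x < 0) := by
  by_contra! hcon
  obtain ⟨⟨x, hx, hfx⟩, y, hy, hfy⟩ := hcon
  obtain ⟨z, hz, hz0⟩ := hs.intermediate_value hx hy hf ⟨hfx, hfy⟩
  exact h z hz hz0

/-- A function with finitely many zeros becomes of one sign after multiplication by a polynomial
with simple zeros at the sign changes. -/
theorem exists_prod_mul_nonneg {f : ℝ → ℝ} {a : ℝ} (Z : Finset ℝ) : ∀ b : ℝ,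
    ContinuousOn f (Set.Ioo a b) → (∀ x ∈ Set.Ioo a b, f x = 0 → x ∈ Z) →
    ∃ S ⊆ Z, ∃ ε : ℝ, (ε = 1 ∨ ε = -1) ∧
      ∀ x ∈ Set.Ioo a b, 0 ≤ ε * ((∏ z ∈ S, (x - z)) * f x) := by
  induction Z using Finset.induction_on_max with
  | empty =>
    intro b hf hZ
    rcases pos_or_neg_of_ne_zero isPreconnected_Ioo hf
      (fun x hx h => absurd (hZ x hx h) (Finset.notMem_empty x)) with h | h
    · exact ⟨∅, subset_rfl, 1, Or.inl rfl, fun x hx => by simpa using (h x hx).le⟩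
    · exact ⟨∅, subset_rfl, -1, Or.inr rfl, fun x hx => by simpa using (h x hx).le⟩
  | insert z Z hz ih =>
    intro b hf hZ
    have hzZ : z ∉ Z := fun h => lt_irrefl z (hz z h)
    by_cases hzI : z ∈ Set.Ioo a b
    · have hsub : Set.Ioo a z ⊆ Set.Ioo a b := Set.Ioo_subset_Ioo_right hzI.2.le
      have hsub' : Set.Ioo z b ⊆ Set.Ioo a b := Set.Ioo_subset_Ioo_left hzI.1.le
      obtain ⟨S, hS, ε, hε, h⟩ := ih z (hf.mono hsub) fun x hx hfx =>
        (Finset.mem_insert.1 (hZ x (hsub hx) hfx)).resolve_left hx.2.ne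
      have hpos : ∀ x ∈ Set.Ioo z b, 0 < ∏ y ∈ S, (x - y) := fun x hx =>
        Finset.prod_pos fun y hy => sub_pos.2 ((hz y (hS hy)).trans hx.1)
      have hsign : (∀ x ∈ Set.Ioo z b, 0 ≤ ε * f x) ∨ (∀ x ∈ Set.Ioo z b, ε * f x ≤ 0) := by
        have h0 : ∀ x ∈ Set.Ioo z b, f x ≠ 0 := fun x hx hfx => by
          rcases Finset.mem_insert.1 (hZ x (hsub' hx) hfx) with rfl | hxZ
          · exact lt_irrefl _ hx.1
          · exact lt_asymm hx.1 (hz x hxZ)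
        rcases pos_or_neg_of_ne_zero isPreconnected_Ioo (hf.mono hsub') h0 with h1 | h1 <;>
          rcases hε with rfl | rfl
        · exact Or.inl fun x hx => by simpa using (h1 x hx).le
        · exact Or.inr fun x hx => by simpa using (h1 x hx).le
        · exact Or.inr fun x hx => by simpa using (h1 x hx).le
        · exact Or.inl fun x hx => by simpa using (h1 x hx).le
      rcases hsign with hs | hs
      -- No sign change at `z`: the set `S` is kept, and the inequality at `z` itself follows by
      -- continuity from the right.
      · by_cases hfz : 0 ≤ ε * ((∏ y ∈ S, (z - y)) * f z)
        · refine ⟨S, hS.trans (Finset.subset_insert _ _), ε, hε, fun x hx => ?_⟩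
          rcases lt_trichotomy x z with hxz | rfl | hxz
          · exact h x ⟨hx.1, hxz⟩
          · exact hfz
          · have := mul_nonneg (hpos x ⟨hxz, hx.2⟩).le (hs x ⟨hxz, hx.2⟩)
            linarith
        · exfalso
          refine hfz ?_
          have hSz : 0 < ∏ y ∈ S, (z - y) := Finset.prod_pos fun y hy => sub_pos.2 (hz y (hS hy))
          have hcl : z ∈ closure (Set.Ioo z b) := by
            rw [closure_Ioo hzI.2.ne]; exact ⟨le_rfl, hzI.2.le⟩
          have hcont : ContinuousWithinAt (fun x => ε * f x) (Set.Ioo z b) z :=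
            (continuousWithinAt_const.mul (hf z hzI)).mono hsub'
          have hfz' : 0 ≤ ε * f z :=
            ContinuousWithinAt.closure_le hcl continuousWithinAt_const hcont hs
          have := mul_nonneg hSz.le hfz'
          linarith
      -- Sign change at `z`: the new factor `x - z` compensates it, and `ε` flips because that
      -- factor is negative to the left of `z`.
      · refine ⟨insert z S, Finset.insert_subset_insert _ hS, -ε, by
          rcases hε with rfl | rfl <;> simp, fun x hx => ?_⟩
        rw [Finset.prod_insert fun hzS => hzZ (hS hzS)]
        rcases lt_trichotomy x z with hxz | rfl | hxz
        · have := mul_nonneg (sub_nonneg.2 hxz.le) (h x ⟨hx.1, hxz⟩)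
          linarith
        · simp
        · have := mul_nonneg (mul_nonneg (sub_nonneg.2 hxz.le) (hpos x ⟨hxz, hx.2⟩).le)
            (neg_nonneg.2 (hs x ⟨hxz, hx.2⟩))
          linarith
    · obtain ⟨S, hS, h⟩ := ih b hf fun x hx hfx =>
        (Finset.mem_insert.1 (hZ x hx hfx)).resolve_left fun hxz => hzI (hxz ▸ hx)
      exact ⟨S, hS.trans (Finset.subset_insert _ _), h⟩

/-! ### Positivity of the type I linear forms -/

section

variable {α β γ : ℝ}

theorem evalForm_eq_sum_rpow (v : ℝ[X]) {x : ℝ} (hx : 0 < x) :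
    evalForm α β v x = ∑ j ∈ v.support, v.coeff j * x ^ exponent α β j :=
  Finset.sum_congr rfl fun j _ => by
    simp only [weightedMonomial_eq_rpow _ _ _ hx]

theorem continuousOn_evalForm (v : ℝ[X]) : ContinuousOn (evalForm α β v) (Set.Ioi 0) := by
  refine ContinuousOn.congr (f := fun x => ∑ j ∈ v.support, v.coeff j * x ^ exponent α β j)
    (fun x hx => ?_) fun x hx => evalForm_eq_sum_rpow v hx
  exact (hasDerivAt_sum_rpow v.support v.coeff (exponent α β) hx).continuousAt.continuousWithinAt

theorem exists_finset_zeros_evalForm (he : Function.Injective (exponent α β)) {v : ℝ[X]}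
    (hv : v ≠ 0) {n : ℕ} (hn : v.degree < ((n + 1 : ℕ) : WithBot ℕ)) :
    ∃ t : Finset ℝ, t.card ≤ n ∧ ∀ x, 0 < x → evalForm α β v x = 0 → x ∈ t := by
  obtain ⟨t, htc, ht⟩ := exists_finset_zeros_sum_rpow v.support (support_nonempty.2 hv) v.coeff
    (exponent α β) he fun j hj => mem_support_iff.1 hj
  refine ⟨t, ?_, fun x hx h => ht x hx (by rw [← evalForm_eq_sum_rpow v hx, h])⟩
  have h1 := card_supp_le_succ_natDegree v
  have h2 := (natDegree_lt_iff_degree_lt hv).2 hn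
  omega

theorem pairing_polyQ_of_natDegree_le (hα : -1 < α) (hβ : -1 < β) (hγ : -1 < γ)
    (he : Function.Injective (exponent α β)) {l : ℕ} {p : ℝ[X]} (hp : p.natDegree ≤ l) :
    pairing α β γ p (polyQ α β γ l) = p.coeff l := by
  conv_lhs => rw [p.as_sum_range_C_mul_X_pow' (Nat.lt_succ_of_le hp)]
  rw [map_sum, LinearMap.sum_apply, Finset.sum_eq_single l]
  · rw [pairing_C_mul, pairing_X_pow_polyQ hα hβ hγ he le_rfl, if_pos rfl, mul_one]
  · intro i hi hil
    rw [pairing_C_mul, pairing_X_pow_polyQ hα hβ hγ he (Nat.lt_succ_iff.1 (Finset.mem_range.1 hi)),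
      if_neg hil, mul_zero]
  · intro h; simp at h

theorem polyQ_ne_zero (hα : -1 < α) (hβ : -1 < β) (hγ : -1 < γ)
    (he : Function.Injective (exponent α β)) (l : ℕ) : polyQ α β γ l ≠ 0 := fun h => by
  simpa [h] using pairing_X_pow_polyQ hα hβ hγ he (le_refl l)

theorem integralMu_pos {f : ℝ → ℝ} (Z : Finset ℝ)
    (hint : IntervalIntegrable (fun x => f x * (1 - x) ^ γ) MeasureTheory.volume 0 1)
    (hf : ∀ x ∈ Set.Ioo (0 : ℝ) 1, 0 ≤ f x) (hZ : ∀ x ∈ Set.Ioo (0 : ℝ) 1, f x = 0 → x ∈ Z) :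
    0 < integralMu γ f := by
  have hae : ∀ᵐ x ∂MeasureTheory.volume.restrict (Set.uIoc (0 : ℝ) 1), 0 ≤ f x * (1 - x) ^ γ := by
    rw [Set.uIoc_of_le zero_le_one, MeasureTheory.Measure.restrict_congr_set
      MeasureTheory.Ioo_ae_eq_Ioc.symm]
    exact (MeasureTheory.ae_restrict_iff' measurableSet_Ioo).2 (Filter.Eventually.of_forall
      fun x hx => mul_nonneg (hf x hx) (Real.rpow_nonneg (sub_nonneg.2 hx.2.le) γ))
  refine (intervalIntegral.integral_pos_iff_support_of_nonneg_ae' hae hint).2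
    ⟨zero_lt_one, ?_⟩
  have hsub : Set.Ioo (0 : ℝ) 1 \ Z ⊆
      (Function.support fun x => f x * (1 - x) ^ γ) ∩ Set.Ioc 0 1 := fun x hx =>
    ⟨mul_ne_zero (fun h => hx.2 (hZ x hx.1 h)) (Real.rpow_pos_of_pos (sub_pos.2 hx.1.2) γ).ne',
      hx.1.1, hx.1.2.le⟩
  refine lt_of_lt_of_le ?_ (MeasureTheory.measure_mono hsub)
  rw [MeasureTheory.measure_sdiff_null (Z.measure_zero _)]
  simp

/-- The type I linear forms are positive to the right of the support of the measure. -/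
theorem evalForm_polyQ_pos (hα : -1 < α) (hβ : -1 < β) (hγ : -1 < γ)
    (he : Function.Injective (exponent α β)) (l : ℕ) {x : ℝ} (hx : 1 ≤ x) :
    0 < evalForm α β (polyQ α β γ l) x := by
  have hv := polyQ_ne_zero hα hβ hγ he l
  obtain ⟨t, htc, ht⟩ := exists_finset_zeros_evalForm he hv (degree_polyQ_lt α β γ l)
  have hcont := continuousOn_evalForm (α := α) (β := β) (polyQ α β γ l)
  set f := evalForm α β (polyQ α β γ l) with hf
  obtain ⟨S, hS, ε, hε, h⟩ := exists_prod_mul_nonneg (f := f) (a := 0)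
    (t.filter (· ∈ Set.Ioo 0 1)) 1 (hcont.mono Set.Ioo_subset_Ioi_self)
    fun x hx hfx => Finset.mem_filter.2 ⟨ht x hx.1 hfx, hx⟩
  have hSt : S ⊆ t := hS.trans (Finset.filter_subset _ _)
  set p : ℝ[X] := ∏ z ∈ S, (X - C z) with hp
  have hpm : p.Monic := monic_prod_X_sub_C _ _
  have hpd : p.natDegree = S.card := natDegree_finsetProd_X_sub_C_eq_card _ _
  have hpe : ∀ x, p.eval x = ∏ z ∈ S, (x - z) := fun x => by simp [hp, eval_prod]
  -- The integral of `p Q^{(l)}` is the coefficient of `X ^ l` in `p`, whereas `ε p Q^{(l)}` is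
  -- nonnegative on `(0, 1)` with finitely many zeros.
  have hpos : 0 < ε * p.coeff l := by
    rw [← pairing_polyQ_of_natDegree_le hα hβ hγ he
      (hpd.trans_le ((Finset.card_le_card hSt).trans htc)), ← pairing_C_mul,
      pairing_eq_integral hα hβ hγ]
    refine integralMu_pos t (intervalIntegrable_eval_mul_evalForm hα hβ hγ _ _) ?_ ?_
    · intro x hx
      simpa [hpe, mul_assoc] using h x hx
    · intro x hx h0
      have hε0 : ε ≠ 0 := by rcases hε with rfl | rfl <;> norm_num
      rw [eval_mul, eval_C, hpe] at h0
      rcases mul_eq_zero.1 h0 with h1 | h1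
      · obtain ⟨z, hz, hz0⟩ := Finset.prod_eq_zero_iff.1 ((mul_eq_zero.1 h1).resolve_left hε0)
        rw [sub_eq_zero.1 hz0]
        exact hSt hz
      · exact ht x hx.1 h1
  have hl : l ≤ S.card := by
    by_contra hlt
    rw [coeff_eq_zero_of_natDegree_lt (by omega), mul_zero] at hpos
    exact lt_irrefl _ hpos
  have hcard : S.card = l := le_antisymm ((Finset.card_le_card hSt).trans htc) hl
  have hε1 : ε = 1 := by
    have : p.coeff l = 1 := by rw [← hcard, ← hpd]; exact hpm
    rcases hε with h1 | h1
    · exact h1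
    · rw [this, h1] at hpos; norm_num at hpos
  -- All the zeros that are allowed are already used up by sign changes inside `(0, 1)`.
  have htS : t = S := (Finset.eq_of_subset_of_card_le hSt (by omega)).symm
  have hlt1 : ∀ z ∈ S, z < 1 := fun z hz => (Finset.mem_filter.1 (hS hz)).2.2
  have hne : ∀ y ∈ Set.Ici (1 : ℝ), f y ≠ 0 := fun y hy hfy => by
    have hyt := ht y (zero_lt_one.trans_le hy) hfy
    rw [htS] at hyt
    exact absurd (hlt1 y hyt) (not_lt.2 hy)
  have hge : 0 ≤ f 1 := by
    have hcl : (1 : ℝ) ∈ closure (Set.Ioo 0 1) := by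
      rw [closure_Ioo zero_ne_one]; exact ⟨zero_le_one, le_rfl⟩
    have hc1 : ContinuousWithinAt (fun x => (∏ z ∈ S, (x - z)) * f x) (Set.Ioo 0 1) 1 :=
      ContinuousWithinAt.mul (Continuous.continuousWithinAt (by fun_prop))
        ((hcont 1 (Set.mem_Ioi.2 zero_lt_one)).mono Set.Ioo_subset_Ioi_self)
    have := ContinuousWithinAt.closure_le hcl continuousWithinAt_const hc1 fun x hx => by
      simpa [hε1] using h x hx
    exact nonneg_of_mul_nonneg_right this (Finset.prod_pos fun z hz => sub_pos.2 (hlt1 z hz))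
  rcases pos_or_neg_of_ne_zero isPreconnected_Ici
    (hcont.mono (Set.Ici_subset_Ioi.2 zero_lt_one)) hne with h1 | h1
  · exact h1 x hx
  · exact absurd (h1 1 (Set.mem_Ici.2 le_rfl)) (not_lt.2 hge)

end

/-! ### Type I pairs as encoded linear forms -/

section

variable {α β γ : ℝ}

/-- The linear form as a linear function of its encoding polynomial. -/
theorem evalForm_eq_lsum (v : ℝ[X]) (x : ℝ) :
    evalForm α β v x =
      Polynomial.lsum (fun j => weightedMonomial α β j x • (LinearMap.id : ℝ →ₗ[ℝ] ℝ)) v := by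
  simp [evalForm, Polynomial.lsum_apply, mul_comm]

theorem evalForm_add (v w : ℝ[X]) (x : ℝ) :
    evalForm α β (v + w) x = evalForm α β v x + evalForm α β w x := by
  simp only [evalForm_eq_lsum, map_add]

theorem evalForm_monomial (j : ℕ) (b x : ℝ) :
    evalForm α β (monomial j b) x = b * weightedMonomial α β j x := by
  rw [evalForm, sum_monomial_index _ _ (by simp)]

theorem weightedMonomial_two_mul (k : ℕ) (x : ℝ) :
    weightedMonomial α β (2 * k) x = x ^ k * x ^ α := by
  simp [weightedMonomial]

theorem weightedMonomial_two_mul_add_one (k : ℕ) (x : ℝ) :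
    weightedMonomial α β (2 * k + 1) x = x ^ k * x ^ β := by
  have : (2 * k + 1) / 2 = k := by omega
  simp [weightedMonomial, this]

/-- The polynomial encoding the linear form `a₁ x^α + a₂ x^β`. -/
def interleave (a₁ a₂ : ℝ[X]) : ℝ[X] := expand ℝ 2 a₁ + X * expand ℝ 2 a₂

theorem evalForm_interleave (a₁ a₂ : ℝ[X]) (x : ℝ) :
    evalForm α β (interleave a₁ a₂) x = a₁.eval x * x ^ α + a₂.eval x * x ^ β := by
  rw [interleave, evalForm_add]
  congr 1
  · induction a₁ using Polynomial.induction_on' with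
    | add p q hp hq => rw [map_add, evalForm_add, hp, hq, eval_add, add_mul]
    | monomial k a =>
      rw [expand_monomial, evalForm_monomial, mul_comm k, weightedMonomial_two_mul, eval_monomial]
      ring
  · induction a₂ using Polynomial.induction_on' with
    | add p q hp hq => rw [map_add, mul_add, evalForm_add, hp, hq, eval_add, add_mul]
    | monomial k a =>
      rw [expand_monomial, X_mul_monomial, evalForm_monomial, mul_comm k,
        weightedMonomial_two_mul_add_one, eval_monomial]
      ring

theorem coeff_interleave_two_mul (a₁ a₂ : ℝ[X]) (k : ℕ) :
    (interleave a₁ a₂).coeff (2 * k) = a₁.coeff k := by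
  rw [interleave, coeff_add, mul_comm 2 k, coeff_expand_mul two_pos]
  cases k with
  | zero => simp
  | succ k =>
    rw [show (k + 1) * 2 = (2 * k + 1) + 1 by ring, coeff_X_mul, coeff_expand two_pos,
      if_neg (by omega), add_zero]

theorem coeff_interleave_two_mul_add_one (a₁ a₂ : ℝ[X]) (k : ℕ) :
    (interleave a₁ a₂).coeff (2 * k + 1) = a₂.coeff k := by
  rw [interleave, coeff_add, coeff_X_mul, coeff_expand two_pos, if_neg (by omega), zero_add,
    mul_comm 2 k, coeff_expand_mul two_pos]

theorem interleave_injective {a₁ a₂ b₁ b₂ : ℝ[X]} (h : interleave a₁ a₂ = interleave b₁ b₂) :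
    a₁ = b₁ ∧ a₂ = b₂ := by
  constructor <;> ext k
  · rw [← coeff_interleave_two_mul a₁ a₂, h, coeff_interleave_two_mul]
  · rw [← coeff_interleave_two_mul_add_one a₁ a₂, h, coeff_interleave_two_mul_add_one]

/-- The step-line counts the even and the odd indices below `n`, so the two degree bounds merge into
one. -/
theorem degree_interleave_lt_iff (a₁ a₂ : ℝ[X]) (n : ℕ) :
    (interleave a₁ a₂).degree < (n : WithBot ℕ) ↔
      a₁.degree < ((stepLine n).1 : WithBot ℕ) ∧ a₂.degree < ((stepLine n).2 : WithBot ℕ) := by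
  simp only [degree_lt_iff_coeff_zero, stepLine]
  constructor
  · intro h
    exact ⟨fun m hm => by rw [← coeff_interleave_two_mul a₁ a₂]; exact h _ (by omega),
      fun m hm => by rw [← coeff_interleave_two_mul_add_one a₁ a₂]; exact h _ (by omega)⟩
  · rintro ⟨h₁, h₂⟩ m hm
    obtain ⟨k, rfl | rfl⟩ := m.even_or_odd'
    · rw [coeff_interleave_two_mul]; exact h₁ _ (by omega)
    · rw [coeff_interleave_two_mul_add_one]; exact h₂ _ (by omega)

theorem interleave_polyA (α β γ : ℝ) (l : ℕ) :
    interleave (polyA₁ α β γ l) (polyA₂ α β γ l) = polyQ α β γ l := by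
  rw [interleave, polyA₁, polyA₂, polyQ, map_sum, map_sum, Finset.mul_sum,
    ← Finset.sum_add_distrib]
  refine Finset.sum_congr rfl fun j _ => ?_
  obtain ⟨k, hk | hk⟩ := (j : ℕ).even_or_odd'
  · rw [hk, if_pos (even_two_mul k), if_pos (even_two_mul k), Nat.mul_div_cancel_left k two_pos]
    simp [expand_C, pow_mul]
  · have h : ¬ Even (2 * k + 1) := by simp
    rw [hk, if_neg h, if_neg h, show (2 * k + 1) / 2 = k by omega]
    simp [expand_C, pow_mul, pow_succ]
    ring

theorem formQ_eq_evalForm (l : ℕ) (x : ℝ) :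
    formQ α β γ l x = evalForm α β (polyQ α β γ l) x := by
  rw [formQ, ← interleave_polyA, evalForm_interleave]

theorem evalForm_one (v : ℝ[X]) : evalForm α β v 1 = v.eval 1 := by
  rw [evalForm, eval_eq_sum]
  simp [weightedMonomial]

theorem stepLine_add (l : ℕ) : (stepLine l).1 + (stepLine l).2 = l := by
  simp only [stepLine]; omega

theorem evalForm_X_pow (j : ℕ) (x : ℝ) :
    evalForm α β (X ^ j) x = weightedMonomial α β j x := by
  rw [← monomial_one_right_eq_X_pow, evalForm_monomial, one_mul]

theorem isMonicTypeII_iff (hα : -1 < α) (hβ : -1 < β) (hγ : -1 < γ) (l : ℕ) (p : ℝ[X]) :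
    IsMonicTypeII α β γ (stepLine l) p ↔ IsMonicOrthogonal α β γ l p := by
  have h₁ : ∀ j, integralMu γ (fun x => p.eval x * x ^ α * x ^ j) =
      pairing α β γ p (X ^ (2 * j)) := fun j => by
    rw [pairing_eq_integral hα hβ hγ]
    simp only [evalForm_X_pow, weightedMonomial_two_mul, mul_assoc, mul_comm (_ ^ α)]
  have h₂ : ∀ j, integralMu γ (fun x => p.eval x * x ^ β * x ^ j) =
      pairing α β γ p (X ^ (2 * j + 1)) := fun j => by
    rw [pairing_eq_integral hα hβ hγ]
    simp only [evalForm_X_pow, weightedMonomial_two_mul_add_one, mul_assoc, mul_comm (_ ^ β)]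
  simp only [IsMonicTypeII, stepLine_add, h₁, h₂]
  constructor
  · rintro ⟨hm, hd, h1, h2⟩
    refine ⟨hm, hd, fun j hj => ?_⟩
    obtain ⟨k, rfl | rfl⟩ := j.even_or_odd'
    · exact h1 k (by simp only [stepLine]; omega)
    · exact h2 k (by simp only [stepLine]; omega)
  · rintro ⟨hm, hd, h⟩
    exact ⟨hm, hd, fun j hj => h _ (by simp only [stepLine] at hj; omega),
      fun j hj => h _ (by simp only [stepLine] at hj; omega)⟩

theorem isTypeI_iff (hα : -1 < α) (hβ : -1 < β) (hγ : -1 < γ)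
    (he : Function.Injective (exponent α β)) (l : ℕ) (a₁ a₂ : ℝ[X]) :
    IsTypeI α β γ (stepLine (l + 1)) a₁ a₂ ↔ a₁ = polyA₁ α β γ l ∧ a₂ = polyA₂ α β γ l := by
  have h : ∀ j, integralMu γ (fun x => x ^ j * (a₁.eval x * x ^ α + a₂.eval x * x ^ β)) =
      pairing α β γ (X ^ j) (interleave a₁ a₂) := fun j => by
    rw [pairing_eq_integral hα hβ hγ]
    simp only [evalForm_interleave, eval_pow, eval_X]
  have hQ : a₁ = polyA₁ α β γ l ∧ a₂ = polyA₂ α β γ l ↔ interleave a₁ a₂ = polyQ α β γ l := by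
    refine ⟨?_, fun h => interleave_injective (h.trans (interleave_polyA α β γ l).symm)⟩
    rintro ⟨rfl, rfl⟩
    exact interleave_polyA α β γ l
  rw [hQ, IsTypeI, ← and_assoc, ← degree_interleave_lt_iff, stepLine_add, Nat.add_sub_cancel]
  simp only [h, add_lt_add_iff_right]
  constructor
  · rintro ⟨hd, h0, h1⟩
    rw [← sub_eq_zero]
    refine eq_zero_of_pairing_X_pow_eq_zero hα hβ hγ he (n := l + 1)
      (lt_of_le_of_lt (degree_sub_le _ _) (max_lt hd (degree_polyQ_lt α β γ l))) fun i hi => ?_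
    rw [map_sub, pairing_X_pow_polyQ hα hβ hγ he (Nat.lt_succ_iff.1 hi), sub_eq_zero]
    split_ifs with hil
    · rw [hil, h1]
    · exact h0 i (by omega)
  · intro hv
    rw [hv]
    refine ⟨degree_polyQ_lt α β γ l, fun j hj => ?_, ?_⟩
    · rw [pairing_X_pow_polyQ hα hβ hγ he hj.le, if_neg hj.ne]
    · rw [pairing_X_pow_polyQ hα hβ hγ he le_rfl, if_pos rfl]

/-! ### The stochastic matrix -/

theorem formQ_pos (hα : -1 < α) (hβ : -1 < β) (hγ : -1 < γ)
    (he : Function.Injective (exponent α β)) (n : ℕ) {x : ℝ} (hx : 1 ≤ x) :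
    0 < formQ α β γ n x := by
  rw [formQ_eq_evalForm]
  exact evalForm_polyQ_pos hα hβ hγ he n hx

/-- The dual recurrence at `x = 1`, where every weighted monomial equals 1, so that a form takes the
value at 1 of its encoding polynomial. -/
theorem sum_formQ_mul_jacobiMatrix (hα : -1 < α) (hβ : -1 < β) (hγ : -1 < γ)
    (he : Function.Injective (exponent α β)) (n : ℕ) :
    ∑ m ∈ Finset.range (n + 3), formQ α β γ m 1 * jacobiMatrix α β γ m n = formQ α β γ n 1 := by
  have h := congrArg (eval 1) (X_sq_mul_polyQ hα hβ hγ he n)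
  simp only [eval_mul, eval_pow, eval_X, eval_finsetSum, eval_C, one_pow, one_mul] at h
  simp only [formQ_eq_evalForm, evalForm_one]
  rw [h]
  exact Finset.sum_congr rfl fun m _ => mul_comm _ _

theorem isMultipleStochasticTypeI_matrixPI (hα : -1 < α) (hβ : -1 < β) (hγ : -1 < γ)
    (he : Function.Injective (exponent α β)) (hlt : |α - β| < 1) :
    IsMultipleStochasticTypeI 2 (matrixPI α β γ) := by
  have hQ := fun n => formQ_pos hα hβ hγ he n le_rfl
  have hnonneg : ∀ i j, 0 ≤ matrixPI α β γ i j := fun i j =>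
    mul_nonneg (div_nonneg (hQ j).le (hQ i).le) (jacobiMatrix_nonneg hα hβ hγ he hlt j i)
  have hzero : ∀ i j, i + 2 < j → matrixPI α β γ i j = 0 := fun i j hij => by
    rw [matrixPI, Matrix.of_apply, jacobiMatrix_eq_zero hα hβ hγ he hlt (Or.inr hij), mul_zero]
  have hsum : ∀ i, HasSum (fun j => matrixPI α β γ i j) 1 := fun i => by
    have h : ∑ j ∈ Finset.range (i + 3), matrixPI α β γ i j = 1 := by
      have hterm : ∀ j, matrixPI α β γ i j =
          formQ α β γ j 1 * jacobiMatrix α β γ j i / formQ α β γ i 1 := fun j => by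
        rw [matrixPI, Matrix.of_apply]; ring
      simp only [hterm]
      rw [← Finset.sum_div, sum_formQ_mul_jacobiMatrix hα hβ hγ he, div_self (hQ i).ne']
    rw [← h]
    refine hasSum_sum_of_ne_finset_zero fun j hj => hzero i j ?_
    rw [Finset.mem_range] at hj
    omega
  refine ⟨⟨fun i j => ⟨hnonneg i j, ?_⟩, hsum⟩, fun i j hij => ?_, hzero⟩
  -- The upper bound is free: a nonnegative term is at most the sum of its row.
  · exact le_hasSum (hsum i) j fun k _ => hnonneg i k
  · rw [matrixPI, Matrix.of_apply, jacobiMatrix_eq_zero hα hβ hγ he hlt (Or.inl hij), mul_zero]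

end

end JacobiPineiro

end

theorem mainTheorem11 (α β γ : ℝ) (hα : -1 < α) (hβ : -1 < β) (hγ : -1 < γ)
    (hne : α ≠ β) (hlt : |α - β| < 1) :
    -- the multiple orthogonal polynomials on the step-line exist, are unique, and are those built
    (∀ (l : ℕ) (p : ℝ[X]),
      JacobiPineiro.IsMonicTypeII α β γ (JacobiPineiro.stepLine l) p ↔
        p = JacobiPineiro.polyB α β γ l) ∧
    (∀ (l : ℕ) (a₁ a₂ : ℝ[X]),
      JacobiPineiro.IsTypeI α β γ (JacobiPineiro.stepLine (l + 1)) a₁ a₂ ↔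
        a₁ = JacobiPineiro.polyA₁ α β γ l ∧ a₂ = JacobiPineiro.polyA₂ α β γ l) ∧
    -- the band structure of the Jacobi matrix
    (∀ n, JacobiPineiro.jacobiMatrix α β γ n (n + 1) = 1) ∧
    (∀ n m, n + 1 < m ∨ m + 2 < n → JacobiPineiro.jacobiMatrix α β γ n m = 0) ∧
    -- the linear forms are positive on `[1, ∞)`, so that one can normalize at `x = 1`
    (∀ (n : ℕ) (x : ℝ), 1 ≤ x → 0 < JacobiPineiro.formQ α β γ n x) ∧
    -- the normalized transposed Jacobi matrix is a type I multiple stochastic matrix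
    JacobiPineiro.IsMultipleStochasticTypeI 2 (JacobiPineiro.matrixPI α β γ) := by
  have he := JacobiPineiro.exponent_injective hne hlt
  refine ⟨fun l p => ?_, JacobiPineiro.isTypeI_iff hα hβ hγ he,
    JacobiPineiro.jacobiMatrix_succ hα hβ hγ he hlt,
    fun n m => JacobiPineiro.jacobiMatrix_eq_zero hα hβ hγ he hlt,
    fun n x => JacobiPineiro.formQ_pos hα hβ hγ he n,
    JacobiPineiro.isMultipleStochasticTypeI_matrixPI hα hβ hγ he hlt⟩
  rw [JacobiPineiro.isMonicTypeII_iff hα hβ hγ]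
  have hB := JacobiPineiro.isMonicOrthogonal_polyB hα hβ hγ he l
  exact ⟨fun h => h.unique hα hβ hγ he hB, fun h => h ▸ hB⟩
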